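/- Let $k$ be a field of characteristic zero and let $L$ be a loop (a set with a unital, not necessarily associative, multiplication in which the equations $ax=b$ and $ya=b$ have unique solutions $x=a\backslash b$ and $y=b/a$). Write $[a,b]=(ba)\backslash(ab)$ for the commutator and $(a,b,c)=(a(bc))\backslash((ab)c)$ for the associator. The associator deviations of level $0$ are the associator itself; the deviations of level $l+1$ are the operations $(A(a_j)A(a_{j+1}))\backslash A(a_ja_{j+1})$, where $A(x)=\varphi(a_1,\dots,a_{j-1},x,a_{j+2},\dots,a_{m+1})$, for all deviations $\varphi$ of level $l$ in $m$ arguments and all $1\le j\le m$. The commutator-associator filtration $L=\gamma_1L\supseteq\gamma_2L\supseteq\cdots$ is defined as follows: for $i\ge 2$, $\gamma_iL$ is the smallest normal subloop of $L$ containing $[\gamma_pL,\gamma_qL]$ for all $p,q\ge 1$ with $p+q\ge i$ and $\varphi(\gamma_{p_1}L,\dots,\gamma_{p_m}L)$ for all associator deviations $\varphi$ (of every level) and all $p_1,\dots,p_m\ge 1$ with $p_1+\dots+p_m\ge i$. The loop $L$ is nilpotent of class $n$ if $n$ is the smallest number with $\gamma_{n+1}L=\{1\}$. It is torsion-free if every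 element $x\ne 1$ generates an infinite subloop. Let $k[L]$ be the loop algebra, $\Delta=\overline{k[L]}$ its augmentation ideal (the kernel of the algebra homomorphism $k[L]\to k$ sending every $g\in L$ to $1$), and $\Delta^{m}$, $m\ge1$, the ideal generated by all products, with any arrangement of parentheses, of at least $m$ elements of $\Delta$. Theorem (Ado theorem for nilpotent loops). Let $L$ be a torsion-free nilpotent loop of class $n$. Then the composition of multiplicative unital maps $$L\hookrightarrow k[L]\to A:=k[L]/\Delta^{n+1}$$ is injective. Moreover, the invertible elements of $A$ (those $a\in A$ for which $x\mapsto ax$ and $y\mapsto ya$ are bijections of $A$) form a loop under multiplication, and this loop contains the image of $L$. If the abelianization of $L$ (its largest abelian group quotient) has finite torsion-free rank, then $A$ is finite-dimensional over $k$. -/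

import Mathlib

/-- A loop: a set with a unital multiplication (not assumed associative) such that the equations
`a * x = b` and `y * a = b` have unique solutions `x = ldiv a b` (that is, `a \ b`) and
`y = rdiv b a` (that is, `b / a`). -/
class AlgebraicLoop (L : Type*) extends MulOneClass L where
  /-- left division `a \ b` -/
  ldiv : L → L → L
  /-- right division `b / a` -/
  rdiv : L → L → L
  mul_ldiv : ∀ a b : L, a * ldiv a b = b
  ldiv_mul : ∀ a b : L, ldiv a (a * b) = b
  rdiv_mul : ∀ a b : L, rdiv b a * a = b
  mul_rdiv : ∀ a b : L, rdiv (b * a) a = b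

namespace AlgebraicLoop

section Loops

variable {L : Type*} [AlgebraicLoop L]

/-- A subloop: a subset that contains `1` and is closed under multiplication and both divisions. -/
structure IsSubloop (N : Set L) : Prop where
  one_mem : (1 : L) ∈ N
  mul_mem : ∀ {a b : L}, a ∈ N → b ∈ N → a * b ∈ N
  ldiv_mem : ∀ {a b : L}, a ∈ N → b ∈ N → ldiv a b ∈ N
  rdiv_mem : ∀ {a b : L}, a ∈ N → b ∈ N → rdiv a b ∈ N

/-- A normal subloop: `xN = Nx`, `x(yN) = (xy)N` and `(Nx)y = N(xy)` for all `x`, `y`. -/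
structure IsNormalSubloop (N : Set L) : Prop extends IsSubloop N where
  comm : ∀ x : L, (fun a => x * a) '' N = (fun a => a * x) '' N
  left_assoc : ∀ x y : L, (fun a => x * (y * a)) '' N = (fun a => (x * y) * a) '' N
  right_assoc : ∀ x y : L, (fun a => (a * x) * y) '' N = (fun a => a * (x * y)) '' N

/-- The subloop generated by a set. -/
def subloopClosure (S : Set L) : Set L :=
  ⋂₀ {N : Set L | IsSubloop N ∧ S ⊆ N}

/-- The smallest normal subloop that contains a set. -/
def normalClosure (S : Set L) : Set L :=
  ⋂₀ {N : Set L | IsNormalSubloop N ∧ S ⊆ N}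

/-- The commutator `[a, b] = (ba) \ (ab)`. -/
def loopCommutator (a b : L) : L := ldiv (b * a) (a * b)

/-- The associator `(a, b, c) = (a(bc)) \ ((ab)c)`. -/
def loopAssociator (a b c : L) : L := ldiv (a * (b * c)) ((a * b) * c)

/-- The deviation of an `m`-ary operation `φ` from being multiplicative in its `j`-th argument, an
operation in `m + 1` arguments: with `A x = φ (a₀, …, a_{j-1}, x, a_{j+2}, …, a_m)` it is
`(A a_j * A a_{j+1}) \ A (a_j * a_{j+1})`. -/
def deviation {m : ℕ} (φ : (Fin m → L) → L) (j : Fin m) (a : Fin (m + 1) → L) : L :=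
  let A : L → L := fun x => φ (Function.update (fun i => a (j.castSucc.succAbove i)) j x)
  ldiv (A (a j.castSucc) * A (a j.succ)) (A (a j.castSucc * a j.succ))

/-- The associator and the associator deviations of all levels, as operations in `m` arguments:
the associator has level zero, and the operations of level `l + 1` are the deviations of the
operations of level `l` in each of their arguments. -/
inductive IsAssociatorDeviation : (m : ℕ) → ((Fin m → L) → L) → Prop
  | associator : IsAssociatorDeviation 3 (fun a => loopAssociator (a 0) (a 1) (a 2))
  | deviation {m : ℕ} {φ : (Fin m → L) → L} (j : Fin m) :
      IsAssociatorDeviation m φ → IsAssociatorDeviation (m + 1) (deviation φ j)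

variable (L) in
/-- The commutator-associator filtration `L = γ₁ L ⊇ γ₂ L ⊇ …`: for `i ≥ 2`, `γ_i L` is the smallest
normal subloop that contains all commutators `[γ_p L, γ_q L]` with `p + q ≥ i` and all values of the
associator and of the associator deviations on `γ_{p₁} L, …, γ_{p_m} L` with `p₁ + … + p_m ≥ i`.
The indices `p` are positive, and smaller than `i`, since a value with an argument in `γ_i L` lies
in every normal subloop that contains `γ_i L`. (By convention `γ₀ L = L`.) -/
def gamma (i : ℕ) : Set L :=
  if i ≤ 1 then Set.univ
  else normalClosure
    ({z | ∃ p q : Fin i, 1 ≤ p.val ∧ 1 ≤ q.val ∧ i ≤ p.val + q.val ∧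
        ∃ a ∈ gamma p.val, ∃ b ∈ gamma q.val, z = loopCommutator a b} ∪
     {z | ∃ (m : ℕ) (φ : (Fin m → L) → L) (p : Fin m → Fin i) (a : Fin m → L),
        IsAssociatorDeviation m φ ∧ (∀ j, 1 ≤ (p j).val) ∧ i ≤ ∑ j, (p j).val ∧
        (∀ j, a j ∈ gamma (p j).val) ∧ z = φ a})
termination_by i
decreasing_by all_goals exact Fin.isLt _

variable (L) in
/-- `L` is nilpotent of class `n`: `n` is the smallest number with `γ_{n+1} L = 1`. -/
def IsNilpotentOfClass (n : ℕ) : Prop :=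
  gamma L (n + 1) = {1} ∧ ∀ m : ℕ, gamma L (m + 1) = {1} → n ≤ m

variable (L) in
/-- `L` is torsion-free: every element other than `1` has infinite order, that is, it generates an
infinite subloop. -/
def IsTorsionFree : Prop :=
  ∀ x : L, x ≠ 1 → (subloopClosure {x}).Infinite

/-- The relations of commutativity and associativity. -/
inductive AbelianRel : L → L → Prop
  | comm (a b : L) : AbelianRel (a * b) (b * a)
  | assoc (a b c : L) : AbelianRel ((a * b) * c) (a * (b * c))

variable (L) in
/-- The abelianization of `L`: its largest quotient that is an abelian group. -/
def LoopAbelianization : Type _ := (conGen (AbelianRel (L := L))).Quotient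

instance : CommGroup (LoopAbelianization L) where
  mul x y := ((show (conGen (AbelianRel (L := L))).Quotient from x) *
    (show (conGen (AbelianRel (L := L))).Quotient from y) :
    (conGen (AbelianRel (L := L))).Quotient)
  one := ((1 : L) : (conGen (AbelianRel (L := L))).Quotient)
  mul_assoc x y z := by
    induction x using Con.induction_on with | _ a
    induction y using Con.induction_on with | _ b
    induction z using Con.induction_on with | _ c
    exact (Con.eq _).2 (ConGen.Rel.of _ _ (AbelianRel.assoc a b c))
  one_mul x := by
    induction x using Con.induction_on with | _ a
    exact congrArg (fun t : L => (t : (conGen (AbelianRel (L := L))).Quotient)) (one_mul a)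
  mul_one x := by
    induction x using Con.induction_on with | _ a
    exact congrArg (fun t : L => (t : (conGen (AbelianRel (L := L))).Quotient)) (mul_one a)
  mul_comm x y := by
    induction x using Con.induction_on with | _ a
    induction y using Con.induction_on with | _ b
    exact (Con.eq _).2 (ConGen.Rel.of _ _ (AbelianRel.comm a b))
  inv x := Con.liftOn x
    (fun a => ((rdiv 1 a : L) : (conGen (AbelianRel (L := L))).Quotient)) (by
      intro a b h
      have hassoc : ∀ u v w : (conGen (AbelianRel (L := L))).Quotient,
          (u * v) * w = u * (v * w) := by
        intro u v w
        induction u using Con.induction_on with | _ a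
        induction v using Con.induction_on with | _ b
        induction w using Con.induction_on with | _ c
        exact (Con.eq _).2 (ConGen.Rel.of _ _ (AbelianRel.assoc a b c))
      have hcomm : ∀ u v : (conGen (AbelianRel (L := L))).Quotient, u * v = v * u := by
        intro u v
        induction u using Con.induction_on with | _ a
        induction v using Con.induction_on with | _ b
        exact (Con.eq _).2 (ConGen.Rel.of _ _ (AbelianRel.comm a b))
      have hinv : ∀ t : L, ((rdiv 1 t : L) : (conGen (AbelianRel (L := L))).Quotient) * (t : L)
          = ((1 : L) : (conGen (AbelianRel (L := L))).Quotient) := by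
        intro t
        rw [← Con.coe_mul, rdiv_mul]
      have hone : ∀ u : (conGen (AbelianRel (L := L))).Quotient,
          ((1 : L) : (conGen (AbelianRel (L := L))).Quotient) * u = u := by
        intro u
        induction u using Con.induction_on with | _ a
        rw [← Con.coe_mul, one_mul]
      have hab : (a : (conGen (AbelianRel (L := L))).Quotient) = b := (Con.eq _).2 h
      calc ((rdiv 1 a : L) : (conGen (AbelianRel (L := L))).Quotient)
          = (((rdiv 1 b : L) : (conGen (AbelianRel (L := L))).Quotient) * (b : L))
              * ((rdiv 1 a : L) : (conGen (AbelianRel (L := L))).Quotient) := by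
            rw [hinv, hone]
        _ = ((rdiv 1 b : L) : (conGen (AbelianRel (L := L))).Quotient) := by
            rw [hassoc, ← hab, hcomm (a : L) _, hinv, hcomm, hone])
  inv_mul_cancel x := by
    induction x using Con.induction_on with | _ a
    exact congrArg (fun t : L => (t : (conGen (AbelianRel (L := L))).Quotient)) (rdiv_mul a 1)

variable (L) in
/-- The abelianization of `L` is an abelian group of finite (torsion-free) rank. -/
def AbelianizationHasFiniteRank : Prop :=
  Module.rank ℤ (Additive (LoopAbelianization L)) < Cardinal.aleph0

end Loops

section Algebras

/-- `IsIdealProduct J m a`: `a` is a product of `m` elements of `J`, for some arrangement of the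
parentheses. -/
inductive IsIdealProduct {R : Type*} [NonUnitalNonAssocRing R] (J : TwoSidedIdeal R) :
    ℕ → R → Prop
  | of {a : R} : a ∈ J → IsIdealProduct J 1 a
  | mul {p q : ℕ} {a b : R} :
      IsIdealProduct J p a → IsIdealProduct J q b → IsIdealProduct J (p + q) (a * b)

/-- The power `J ^ m`, `m ≥ 1`, of an ideal of a non-associative ring: the ideal generated by all
products, with any arrangement of the parentheses, of at least `m` elements of `J`. -/
def idealPow {R : Type*} [NonUnitalNonAssocRing R] (J : TwoSidedIdeal R) (m : ℕ) :
    TwoSidedIdeal R :=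
  TwoSidedIdeal.span {a | ∃ m' : ℕ, m ≤ m' ∧ IsIdealProduct J m' a}

/-- An element `a` of a non-associative unital ring is invertible if the equations `a * x = b` and
`y * a = b` have unique solutions for every `b`. -/
def IsInvertibleElement {A : Type*} [NonAssocRing A] (a : A) : Prop :=
  Function.Bijective (fun x : A => a * x) ∧ Function.Bijective (fun y : A => y * a)

/-- A subset of a non-associative unital ring is a loop with respect to the multiplication. -/
structure FormsLoop {A : Type*} [NonAssocRing A] (U : Set A) : Prop where
  one_mem : (1 : A) ∈ U
  mul_mem : ∀ a ∈ U, ∀ b ∈ U, a * b ∈ U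
  left_division : ∀ a ∈ U, ∀ b ∈ U, ∃! x : A, x ∈ U ∧ a * x = b
  right_division : ∀ a ∈ U, ∀ b ∈ U, ∃! y : A, y ∈ U ∧ y * a = b

variable (k L : Type*) [Field k] [AlgebraicLoop L]

/-- The augmentation `k[L] → k`, which sends every element of `L` to `1`. -/
noncomputable def augmentation : MonoidAlgebra k L →ₙₐ[k] k :=
  MonoidAlgebra.liftMagma k ((1 : L →* k) : L →ₙ* k)

/-- The augmentation ideal of the loop algebra `k[L]`. -/
noncomputable def augmentationIdeal : TwoSidedIdeal (MonoidAlgebra k L) :=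
  TwoSidedIdeal.ker (augmentation k L)

/-- The quotient of the loop algebra `k[L]` by the `m`-th power of its augmentation ideal. -/
abbrev LoopAlgebraQuotient (m : ℕ) : Type _ :=
  (idealPow (augmentationIdeal k L) m).ringCon.Quotient

noncomputable instance (m : ℕ) : Module k (LoopAlgebraQuotient k L m) where
  add_smul r s x := by
    obtain ⟨a, rfl⟩ := RingCon.mk'_surjective _ x
    change _ • (a : LoopAlgebraQuotient k L m) = _
    rw [← RingCon.coe_smul, add_smul, RingCon.coe_add, RingCon.coe_smul, RingCon.coe_smul]
    rfl
  zero_smul x := by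
    obtain ⟨a, rfl⟩ := RingCon.mk'_surjective _ x
    change _ • (a : LoopAlgebraQuotient k L m) = _
    rw [← RingCon.coe_smul, zero_smul, RingCon.coe_zero]

/-- The composition `L → k[L] → k[L] / Δ ^ m`, where `Δ` is the augmentation ideal. -/
noncomputable def toLoopAlgebraQuotient (m : ℕ) : L →* LoopAlgebraQuotient k L m :=
  (RingCon.mk' (idealPow (augmentationIdeal k L) m).ringCon : MonoidAlgebra k L →*
    LoopAlgebraQuotient k L m).comp (MonoidAlgebra.of k L)

end Algebras

end AlgebraicLoop

/-! Injectivity is the statement that `g - 1 ∈ Δ ^ (n + 1)` forces `g = 1`. It is proved without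
building a Lie-type structure, by means of cubes in the style of Host and Kra.

The quotients of the filtration `gamma` may have torsion. Zorn's lemma gives a maximal filtration
`Φ` with the same formal properties and `Φ (n + 1) = {1}`; maximality forces every quotient `Φ i / Φ
(i + 1)` to be torsion-free (`exists_isIsolated`). The point is that replacing `Φ (i + 1)` by its
isolator in `Φ i` keeps a filtration when the later quotients are torsion-free
(`IsFiltration.update_isolator`).

A cube is a function on the vertices of `{0,1}^ι` in the loop generated by the functions equal to `g
∈ Φ |J|` on the face given by `J` and to `1` elsewhere. The alternating sum over a one-dimensional
cube can be `g - 1`, and products of alternating sums are alternating sums over cubes of added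
dimension, so `Δ ^ m` lies in the span of alternating sums over cubes of dimension at least `m`
(`augPow_le_cubeSpan`).

Now suppose that `g ∈ Φ i` and that `g - 1` is a combination of alternating sums over cubes of
dimension greater than `i` with values in `Φ i`. Only finitely many elements occur, so modulo `Φ (i
+ 1)` one may work in a free abelian group of finite rank and remove one infinite cyclic factor at a
time. The exponent of that factor is an additive function, whose alternating sums vanish on cubes of
dimension greater than `i`; in characteristic zero the exponent of `g` is therefore zero. Dividing
the factor out is a retraction that maps cubes to cubes (`comp_mem_cubes`), so the whole relation
moves to the smaller subloop (`single_sub_one_mem_of_sup_zpowers`). After `n` layers `g` lies in `Φ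
(n + 1) = {1}`.

For the other claims, multiplication by `a` acts on each `Δ ^ j / Δ ^ (j + 1)` as the scalar given
by the augmentation of `a`, so invertible means nonzero augmentation (`isInvertibleElement_coe`).
Finite rank of the abelianization bounds `Δ / Δ ^ 2`, and the products then bound the higher powers.
-/

namespace AlgebraicLoop

/-! ### Elementary theory of loops: divisions, subloops, quotients, centre. -/

section Basic

variable {L : Type*} [AlgebraicLoop L]

theorem left_cancel {a b c : L} (h : a * b = a * c) : b = c := by
  rw [← ldiv_mul a b, h, ldiv_mul]

theorem right_cancel {a b c : L} (h : b * a = c * a) : b = c := by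
  rw [← mul_rdiv a b, h, mul_rdiv]

theorem ldiv_eq_iff {a b c : L} : ldiv a b = c ↔ b = a * c :=
  ⟨fun h => by rw [← h, mul_ldiv], fun h => by rw [h, ldiv_mul]⟩

theorem rdiv_eq_iff {a b c : L} : rdiv b a = c ↔ b = c * a :=
  ⟨fun h => by rw [← h, rdiv_mul], fun h => by rw [h, mul_rdiv]⟩

@[simp] theorem ldiv_self (a : L) : ldiv a a = 1 := ldiv_eq_iff.2 (mul_one a).symm

@[simp] theorem rdiv_self (a : L) : rdiv a a = 1 := rdiv_eq_iff.2 (one_mul a).symm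

@[simp] theorem ldiv_one_left (a : L) : ldiv 1 a = a := ldiv_eq_iff.2 (one_mul a).symm

theorem loopCommutator_eq_one_iff {a b : L} : loopCommutator a b = 1 ↔ a * b = b * a := by
  rw [loopCommutator, ldiv_eq_iff, mul_one]

theorem loopAssociator_eq_one_iff {a b c : L} :
    loopAssociator a b c = 1 ↔ (a * b) * c = a * (b * c) := by
  rw [loopAssociator, ldiv_eq_iff, mul_one]

variable {L' : Type*} [AlgebraicLoop L']

theorem map_ldiv (f : L →* L') (a b : L) : f (ldiv a b) = ldiv (f a) (f b) :=
  (ldiv_eq_iff.2 (by rw [← map_mul, mul_ldiv])).symm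

theorem map_rdiv (f : L →* L') (a b : L) : f (rdiv a b) = rdiv (f a) (f b) :=
  (rdiv_eq_iff.2 (by rw [← map_mul, rdiv_mul])).symm

theorem map_loopCommutator (f : L →* L') (a b : L) :
    f (loopCommutator a b) = loopCommutator (f a) (f b) := by
  simp only [loopCommutator, map_ldiv, map_mul]

theorem map_loopAssociator (f : L →* L') (a b c : L) :
    f (loopAssociator a b c) = loopAssociator (f a) (f b) (f c) := by
  simp only [loopAssociator, map_ldiv, map_mul]

/-- Pointwise operations make functions with values in a loop into a loop. -/
instance piLoop {ι : Type*} : AlgebraicLoop (ι → L) where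
  ldiv f g := fun i => ldiv (f i) (g i)
  rdiv f g := fun i => rdiv (f i) (g i)
  mul_ldiv _ _ := funext fun _ => mul_ldiv _ _
  ldiv_mul _ _ := funext fun _ => ldiv_mul _ _
  rdiv_mul _ _ := funext fun _ => rdiv_mul _ _
  mul_rdiv _ _ := funext fun _ => mul_rdiv _ _

theorem pi_ldiv_apply {ι : Type*} (f g : ι → L) (i : ι) : ldiv f g i = ldiv (f i) (g i) := rfl

theorem pi_rdiv_apply {ι : Type*} (f g : ι → L) (i : ι) : rdiv f g i = rdiv (f i) (g i) := rfl

theorem pi_loopCommutator_apply {ι : Type*} (f g : ι → L) (i : ι) :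
    loopCommutator f g i = loopCommutator (f i) (g i) := rfl

end Basic

section Subloops

variable {L : Type*} [AlgebraicLoop L]

theorem isSubloop_subloopClosure (S : Set L) : IsSubloop (subloopClosure S) where
  one_mem := fun _ hN => hN.1.one_mem
  mul_mem := fun ha hb N hN => hN.1.mul_mem (ha N hN) (hb N hN)
  ldiv_mem := fun ha hb N hN => hN.1.ldiv_mem (ha N hN) (hb N hN)
  rdiv_mem := fun ha hb N hN => hN.1.rdiv_mem (ha N hN) (hb N hN)

theorem subset_subloopClosure (S : Set L) : S ⊆ subloopClosure S :=
  fun _ ha _ hN => hN.2 ha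

theorem subloopClosure_subset {S N : Set L} (hN : IsSubloop N) (h : S ⊆ N) :
    subloopClosure S ⊆ N := fun _ ha => ha N ⟨hN, h⟩

theorem subloopClosure_mono {S T : Set L} (h : S ⊆ T) : subloopClosure S ⊆ subloopClosure T :=
  subloopClosure_subset (isSubloop_subloopClosure T) (h.trans (subset_subloopClosure T))

theorem subloopClosure_induction {S : Set L} {P : L → Prop} (mem : ∀ x ∈ S, P x) (one : P 1)
    (mul : ∀ x y, x ∈ subloopClosure S → y ∈ subloopClosure S → P x → P y → P (x * y))
    (left : ∀ x y, x ∈ subloopClosure S → y ∈ subloopClosure S → P x → P y → P (ldiv x y))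
    (right : ∀ x y, x ∈ subloopClosure S → y ∈ subloopClosure S → P x → P y → P (rdiv x y))
    {x : L} (hx : x ∈ subloopClosure S) : P x := by
  have hc := isSubloop_subloopClosure S
  have : IsSubloop {x | x ∈ subloopClosure S ∧ P x} :=
    { one_mem := ⟨hc.one_mem, one⟩
      mul_mem := fun ha hb => ⟨hc.mul_mem ha.1 hb.1, mul _ _ ha.1 hb.1 ha.2 hb.2⟩
      ldiv_mem := fun ha hb => ⟨hc.ldiv_mem ha.1 hb.1, left _ _ ha.1 hb.1 ha.2 hb.2⟩
      rdiv_mem := fun ha hb => ⟨hc.rdiv_mem ha.1 hb.1, right _ _ ha.1 hb.1 ha.2 hb.2⟩ }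
  exact (subloopClosure_subset this (fun x hx => ⟨subset_subloopClosure S hx, mem x hx⟩) hx).2

/-- The type of elements of a subloop. -/
def IsSubloop.Carrier {S : Set L} (_hS : IsSubloop S) : Type _ := S

instance {S : Set L} (hS : IsSubloop S) : AlgebraicLoop hS.Carrier where
  mul a b := ⟨a.1 * b.1, hS.mul_mem a.2 b.2⟩
  one := ⟨1, hS.one_mem⟩
  one_mul a := Subtype.ext (one_mul a.1)
  mul_one a := Subtype.ext (mul_one a.1)
  ldiv a b := ⟨ldiv a.1 b.1, hS.ldiv_mem a.2 b.2⟩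
  rdiv a b := ⟨rdiv a.1 b.1, hS.rdiv_mem a.2 b.2⟩
  mul_ldiv a b := Subtype.ext (mul_ldiv a.1 b.1)
  ldiv_mul a b := Subtype.ext (ldiv_mul a.1 b.1)
  rdiv_mul a b := Subtype.ext (rdiv_mul a.1 b.1)
  mul_rdiv a b := Subtype.ext (mul_rdiv a.1 b.1)

/-- Closure under maps applied to a single element of `N`, unlike equality of sets of cosets, passes
at once to intersections and to unions of chains. -/
theorem isNormalSubloop_iff {N : Set L} : IsNormalSubloop N ↔ IsSubloop N ∧
    ∀ a ∈ N, ∀ x y : L, rdiv (x * a) x ∈ N ∧ ldiv x (a * x) ∈ N ∧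
      ldiv (x * y) (x * (y * a)) ∈ N ∧ ldiv y (ldiv x ((x * y) * a)) ∈ N ∧
      rdiv ((a * x) * y) (x * y) ∈ N ∧ rdiv (rdiv (a * (x * y)) y) x ∈ N := by
  constructor
  · intro hN
    refine ⟨hN.toIsSubloop, fun a ha x y => ⟨?_, ?_, ?_, ?_, ?_, ?_⟩⟩
    · obtain ⟨b, hb, h⟩ := (hN.comm x).subset ⟨a, ha, rfl⟩
      rwa [rdiv_eq_iff.2 h.symm]
    · obtain ⟨b, hb, h⟩ := (hN.comm x).superset ⟨a, ha, rfl⟩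
      rwa [ldiv_eq_iff.2 h.symm]
    · obtain ⟨b, hb, h⟩ := (hN.left_assoc x y).subset ⟨a, ha, rfl⟩
      rwa [ldiv_eq_iff.2 h.symm]
    · obtain ⟨b, hb, h⟩ := (hN.left_assoc x y).superset ⟨a, ha, rfl⟩
      rwa [ldiv_eq_iff.2 (ldiv_eq_iff.2 h.symm)]
    · obtain ⟨b, hb, h⟩ := (hN.right_assoc x y).subset ⟨a, ha, rfl⟩
      rwa [rdiv_eq_iff.2 h.symm]
    · obtain ⟨b, hb, h⟩ := (hN.right_assoc x y).superset ⟨a, ha, rfl⟩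
      rwa [rdiv_eq_iff.2 (rdiv_eq_iff.2 h.symm)]
  · rintro ⟨hs, h⟩
    refine { toIsSubloop := hs, comm := fun x => ?_, left_assoc := fun x y => ?_,
             right_assoc := fun x y => ?_ }
    · ext z
      constructor
      · rintro ⟨a, ha, rfl⟩
        exact ⟨_, (h a ha x 1).1, rdiv_mul _ _⟩
      · rintro ⟨a, ha, rfl⟩
        exact ⟨_, (h a ha x 1).2.1, mul_ldiv _ _⟩
    · ext z
      constructor
      · rintro ⟨a, ha, rfl⟩
        exact ⟨_, (h a ha x y).2.2.1, mul_ldiv _ _⟩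
      · rintro ⟨a, ha, rfl⟩
        exact ⟨_, (h a ha x y).2.2.2.1, by simp only [mul_ldiv]⟩
    · ext z
      constructor
      · rintro ⟨a, ha, rfl⟩
        exact ⟨_, (h a ha x y).2.2.2.2.1, rdiv_mul _ _⟩
      · rintro ⟨a, ha, rfl⟩
        exact ⟨_, (h a ha x y).2.2.2.2.2, by simp only [rdiv_mul]⟩

theorem isNormalSubloop_univ : IsNormalSubloop (Set.univ : Set L) :=
  isNormalSubloop_iff.2 ⟨⟨trivial, fun _ _ => trivial, fun _ _ => trivial, fun _ _ => trivial⟩,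
    fun _ _ _ _ => ⟨trivial, trivial, trivial, trivial, trivial, trivial⟩⟩

theorem isNormalSubloop_singleton_one : IsNormalSubloop ({1} : Set L) := by
  refine isNormalSubloop_iff.2 ⟨⟨rfl, ?_, ?_, ?_⟩, ?_⟩
  · rintro _ _ rfl rfl; exact mul_one _
  · rintro _ _ rfl rfl; exact ldiv_self _
  · rintro _ _ rfl rfl; exact rdiv_self _
  · rintro _ rfl x y
    simp [ldiv_mul, mul_rdiv]

theorem isNormalSubloop_normalClosure (S : Set L) : IsNormalSubloop (normalClosure S) := by
  refine isNormalSubloop_iff.2 ⟨⟨?_, ?_, ?_, ?_⟩, ?_⟩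
  · exact fun N hN => hN.1.one_mem
  · exact fun ha hb N hN => hN.1.mul_mem (ha N hN) (hb N hN)
  · exact fun ha hb N hN => hN.1.ldiv_mem (ha N hN) (hb N hN)
  · exact fun ha hb N hN => hN.1.rdiv_mem (ha N hN) (hb N hN)
  · intro a ha x y
    have key := fun N (hN : N ∈ {N : Set L | IsNormalSubloop N ∧ S ⊆ N}) =>
      (isNormalSubloop_iff.1 hN.1).2 a (ha N hN) x y
    exact ⟨fun N hN => (key N hN).1, fun N hN => (key N hN).2.1, fun N hN => (key N hN).2.2.1,
      fun N hN => (key N hN).2.2.2.1, fun N hN => (key N hN).2.2.2.2.1,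
      fun N hN => (key N hN).2.2.2.2.2⟩

theorem subset_normalClosure (S : Set L) : S ⊆ normalClosure S := fun _ ha _ hN => hN.2 ha

theorem normalClosure_subset {S N : Set L} (hN : IsNormalSubloop N) (h : S ⊆ N) :
    normalClosure S ⊆ N := fun _ ha => ha N ⟨hN, h⟩

/-- The congruence whose classes are the cosets of a normal subloop. -/
def IsNormalSubloop.con {N : Set L} (hN : IsNormalSubloop N) : Con L where
  r a b := ∃ n ∈ N, b = a * n
  iseqv :=
    { refl := fun a => ⟨1, hN.one_mem, (mul_one a).symm⟩
      symm := by
        rintro a _ ⟨n, hn, rfl⟩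
        obtain ⟨m, hm, h⟩ := (hN.left_assoc a n).subset ⟨ldiv n 1, hN.ldiv_mem hn hN.one_mem, rfl⟩
        exact ⟨m, hm, by simpa [mul_ldiv] using h.symm⟩
      trans := by
        rintro a _ _ ⟨n, hn, rfl⟩ ⟨m, hm, rfl⟩
        obtain ⟨l, hl, h⟩ := (hN.left_assoc a n).superset ⟨m, hm, rfl⟩
        exact ⟨n * l, hN.mul_mem hn hl, h.symm⟩ }
  mul' := by
    rintro a _ b _ ⟨n, hn, rfl⟩ ⟨m, hm, rfl⟩
    obtain ⟨m₁, hm₁, h₁⟩ := (hN.left_assoc (a * n) b).subset ⟨m, hm, rfl⟩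
    obtain ⟨n₁, hn₁, h₂⟩ := (hN.comm a).subset ⟨n, hn, rfl⟩
    obtain ⟨n₂, hn₂, h₃⟩ := (hN.right_assoc a b).subset ⟨n₁, hn₁, rfl⟩
    obtain ⟨n₃, hn₃, h₄⟩ := (hN.comm (a * b)).superset ⟨n₂, hn₂, rfl⟩
    obtain ⟨m₂, hm₂, h₅⟩ := (hN.left_assoc (a * b) n₃).superset ⟨m₁, hm₁, rfl⟩
    refine ⟨n₃ * m₂, hN.mul_mem hn₃ hm₂, ?_⟩
    simp only at h₁ h₂ h₃ h₄ h₅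
    rw [h₅, ← h₁, h₄, h₃, h₂]

theorem IsNormalSubloop.con_iff {N : Set L} (hN : IsNormalSubloop N) {a b : L} :
    hN.con a b ↔ ∃ n ∈ N, b = a * n := Iff.rfl

theorem IsNormalSubloop.con_left_cancel {N : Set L} (hN : IsNormalSubloop N) {a b c : L}
    (h : hN.con (a * b) (a * c)) : hN.con b c := by
  obtain ⟨n, hn, h⟩ := hN.con_iff.1 h
  obtain ⟨m, hm, h'⟩ := (hN.left_assoc a b).superset ⟨n, hn, rfl⟩
  exact ⟨m, hm, left_cancel (h.trans h'.symm)⟩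

theorem IsNormalSubloop.con_right_cancel {N : Set L} (hN : IsNormalSubloop N) {a b c : L}
    (h : hN.con (b * a) (c * a)) : hN.con b c := by
  obtain ⟨n, hn, h⟩ := hN.con_iff.1 h
  obtain ⟨n₁, hn₁, h₁⟩ := (hN.comm (b * a)).subset ⟨n, hn, rfl⟩
  obtain ⟨n₂, hn₂, h₂⟩ := (hN.right_assoc b a).superset ⟨n₁, hn₁, rfl⟩
  obtain ⟨n₃, hn₃, h₃⟩ := (hN.comm b).superset ⟨n₂, hn₂, rfl⟩
  refine ⟨n₃, hn₃, right_cancel (a := a) ?_⟩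
  simp only at h₁ h₂ h₃
  rw [h, ← h₁, ← h₂, h₃]

/-- The quotient of a loop by a normal subloop. -/
def IsNormalSubloop.Quotient {N : Set L} (hN : IsNormalSubloop N) : Type _ := hN.con.Quotient

instance {N : Set L} (hN : IsNormalSubloop N) : MulOneClass hN.Quotient :=
  inferInstanceAs (MulOneClass hN.con.Quotient)

/-- The projection of a loop onto the quotient by a normal subloop. -/
def IsNormalSubloop.proj {N : Set L} (hN : IsNormalSubloop N) : L →* hN.Quotient := hN.con.mk'

theorem IsNormalSubloop.proj_surjective {N : Set L} (hN : IsNormalSubloop N) :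
    Function.Surjective hN.proj := Con.mk'_surjective

theorem IsNormalSubloop.proj_eq_proj {N : Set L} (hN : IsNormalSubloop N) {a b : L} :
    hN.proj a = hN.proj b ↔ ∃ n ∈ N, b = a * n := hN.con.eq

theorem IsNormalSubloop.proj_eq_one {N : Set L} (hN : IsNormalSubloop N) {a : L} :
    hN.proj a = 1 ↔ a ∈ N := by
  rw [← map_one hN.proj, eq_comm, hN.proj_eq_proj]
  constructor
  · rintro ⟨n, hn, rfl⟩
    rwa [one_mul]
  · exact fun h => ⟨a, h, (one_mul a).symm⟩

instance {N : Set L} (hN : IsNormalSubloop N) : AlgebraicLoop hN.Quotient where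
  ldiv x y := Con.liftOn₂ x y (fun a b => hN.proj (ldiv a b)) (by
    intro a b a' b' ha hb
    refine hN.con.eq.2 (hN.con_left_cancel (a := a) ?_)
    rw [mul_ldiv]
    refine hN.con.trans hb ?_
    conv_lhs => rw [← mul_ldiv a' b']
    exact hN.con.mul (hN.con.symm ha) (hN.con.refl _))
  rdiv x y := Con.liftOn₂ x y (fun a b => hN.proj (rdiv a b)) (by
    intro a b a' b' ha hb
    refine hN.con.eq.2 (hN.con_right_cancel (a := b) ?_)
    rw [rdiv_mul]
    refine hN.con.trans ha ?_
    conv_lhs => rw [← rdiv_mul b' a']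
    exact hN.con.mul (hN.con.refl _) (hN.con.symm hb))
  mul_ldiv x y := by
    obtain ⟨a, rfl⟩ := hN.proj_surjective x
    obtain ⟨b, rfl⟩ := hN.proj_surjective y
    exact congrArg hN.proj (mul_ldiv a b)
  ldiv_mul x y := by
    obtain ⟨a, rfl⟩ := hN.proj_surjective x
    obtain ⟨b, rfl⟩ := hN.proj_surjective y
    exact congrArg hN.proj (ldiv_mul a b)
  rdiv_mul x y := by
    obtain ⟨a, rfl⟩ := hN.proj_surjective x
    obtain ⟨b, rfl⟩ := hN.proj_surjective y
    exact congrArg hN.proj (rdiv_mul a b)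
  mul_rdiv x y := by
    obtain ⟨a, rfl⟩ := hN.proj_surjective x
    obtain ⟨b, rfl⟩ := hN.proj_surjective y
    exact congrArg hN.proj (mul_rdiv a b)

end Subloops

section Center

variable {L : Type*} [AlgebraicLoop L]

/-- An element that commutes and associates with all elements. -/
structure IsCentral (z : L) : Prop where
  comm : ∀ x, z * x = x * z
  left : ∀ x y, (z * x) * y = z * (x * y)
  mid : ∀ x y, (x * z) * y = x * (z * y)
  right : ∀ x y, (x * y) * z = x * (y * z)

theorem IsCentral.one : IsCentral (1 : L) :=
  ⟨fun x => by simp, fun x y => by simp, fun x y => by simp, fun x y => by simp⟩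

theorem IsCentral.mul {z w : L} (hz : IsCentral z) (hw : IsCentral w) : IsCentral (z * w) where
  comm x := by rw [hz.left, hw.comm, ← hz.left, hz.comm x, hz.mid]
  left x y := by rw [hz.left, hz.left, hw.left, hz.left]
  mid x y := by rw [← hz.mid, hw.mid, hz.mid, hz.left]
  right x y := by rw [← hw.right, hz.right, hw.right, hw.right]

theorem IsCentral.ldiv_one {z : L} (hz : IsCentral z) : IsCentral (ldiv z 1) := by
  have hw : z * ldiv z 1 = 1 := mul_ldiv z 1
  set w := ldiv z 1
  have hc : ∀ x, w * x = x * w := fun x => left_cancel (a := z) (by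
    rw [← hz.left, hw, one_mul, ← hz.left, hz.comm, hz.mid, hw, mul_one])
  have hl : ∀ x y, (w * x) * y = w * (x * y) := fun x y => left_cancel (a := z) (by
    rw [← hz.left, ← hz.left, hw, one_mul, ← hz.left, hw, one_mul])
  have hm : ∀ x y, (x * w) * y = x * (w * y) := fun x y => by
    rw [← hc, hl]
    refine left_cancel (a := z) ?_
    rw [← hz.left, hw, one_mul, ← hz.left, hz.comm, hz.mid, ← hz.left, hw, one_mul]
  exact ⟨hc, hl, hm, fun x y => by rw [← hc, ← hl, hc, hm, hc]⟩

theorem IsCentral.ldiv_eq {z : L} (hz : IsCentral z) (x : L) : ldiv z x = ldiv z 1 * x :=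
  ldiv_eq_iff.2 (by rw [← hz.left, mul_ldiv, one_mul])

theorem IsCentral.rdiv_eq {z : L} (hz : IsCentral z) (x : L) : rdiv x z = ldiv z 1 * x :=
  rdiv_eq_iff.2 (by rw [← hz.comm, ← hz.left, mul_ldiv, one_mul])

variable (L) in
/-- The center of a loop, an abelian group. -/
def Center : Type _ := {z : L // IsCentral z}

instance : CommGroup (Center L) where
  mul z w := ⟨z.1 * w.1, z.2.mul w.2⟩
  one := ⟨1, IsCentral.one⟩
  inv z := ⟨ldiv z.1 1, z.2.ldiv_one⟩
  one_mul z := Subtype.ext (one_mul z.1)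
  mul_one z := Subtype.ext (mul_one z.1)
  mul_assoc z w _ := Subtype.ext (z.2.left _ _)
  mul_comm z w := Subtype.ext (z.2.comm _)
  inv_mul_cancel z := Subtype.ext ((z.2.comm _).symm.trans (mul_ldiv z.1 1))

/-- The inclusion of the center. -/
def Center.val : Center L →* L where
  toFun z := z.1
  map_one' := rfl
  map_mul' _ _ := rfl

theorem Center.val_injective : Function.Injective (Center.val (L := L)) := Subtype.val_injective

theorem Center.isCentral (z : Center L) : IsCentral z.val := z.2

theorem Center.val_inv (z : Center L) : (z⁻¹).val = ldiv z.val 1 := rfl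

theorem exists_center {z : L} (h : IsCentral z) : ∃ w : Center L, w.val = z := ⟨⟨z, h⟩, rfl⟩

theorem Center.val_inv_mul (z w : Center L) : (z⁻¹ * w).val = ldiv z.val w.val := by
  rw [map_mul, z.val_inv, z.isCentral.ldiv_eq w.val]

theorem Center.val_mul_inv (z w : Center L) : (w * z⁻¹).val = rdiv w.val z.val := by
  rw [mul_comm, map_mul, z.val_inv, z.isCentral.rdiv_eq w.val]

/-- A subloop whose image in the quotient by a smaller normal subloop is central is normal. -/
theorem IsSubloop.isNormalSubloop_of_central {N S : Set L} (hS : IsSubloop S)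
    (hN : IsNormalSubloop N) (hNS : N ⊆ S) (h : ∀ a ∈ S, IsCentral (hN.proj a)) :
    IsNormalSubloop S := by
  have key : ∀ a ∈ S, ∀ b, hN.proj a = hN.proj b → b ∈ S := by
    intro a ha b hab
    obtain ⟨n, hn, rfl⟩ := hN.proj_eq_proj.1 hab
    exact hS.mul_mem ha (hNS hn)
  refine isNormalSubloop_iff.2 ⟨hS, fun a ha x y => ?_⟩
  have hc := h a ha
  refine ⟨key a ha _ ?_, key a ha _ ?_, key a ha _ ?_, key a ha _ ?_, key a ha _ ?_,
    key a ha _ ?_⟩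
  · rw [map_rdiv, map_mul, ← hc.comm, mul_rdiv]
  · rw [map_ldiv, map_mul, hc.comm, ldiv_mul]
  · rw [map_ldiv, map_mul, map_mul, map_mul, ← hc.right, ldiv_mul]
  · rw [map_ldiv, map_ldiv, map_mul, map_mul, hc.right, ldiv_mul, ldiv_mul]
  · rw [map_rdiv, map_mul, map_mul, map_mul, hc.left, mul_rdiv]
  · rw [map_rdiv, map_rdiv, map_mul, map_mul, ← hc.left, mul_rdiv, mul_rdiv]

/-- Centrality modulo a normal subloop, in terms of commutators and associators. -/
theorem IsNormalSubloop.isCentral_proj {N : Set L} (hN : IsNormalSubloop N) {z : L}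
    (hc : ∀ x, loopCommutator z x ∈ N) (hl : ∀ x y, loopAssociator z x y ∈ N)
    (hm : ∀ x y, loopAssociator x z y ∈ N) (hr : ∀ x y, loopAssociator x y z ∈ N) :
    IsCentral (hN.proj z) := by
  refine ⟨fun x => ?_, fun x y => ?_, fun x y => ?_, fun x y => ?_⟩ <;>
    obtain ⟨x, rfl⟩ := hN.proj_surjective x
  · exact loopCommutator_eq_one_iff.1 (by rw [← map_loopCommutator]; exact hN.proj_eq_one.2 (hc x))
  all_goals obtain ⟨y, rfl⟩ := hN.proj_surjective y
  · exact loopAssociator_eq_one_iff.1 (by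
      rw [← map_loopAssociator]; exact hN.proj_eq_one.2 (hl x y))
  · exact loopAssociator_eq_one_iff.1 (by
      rw [← map_loopAssociator]; exact hN.proj_eq_one.2 (hm x y))
  · exact loopAssociator_eq_one_iff.1 (by
      rw [← map_loopAssociator]; exact hN.proj_eq_one.2 (hr x y))

end Center

/-! ### Associator deviations. -/

section Deviations

theorem forall_insertNth_update {L : Type*} {m : ℕ} {α : Type*} (P : L → α → Prop) (a : Fin m → L)
    (p : Fin m → α) (j : Fin m) {x y : L} {u v : α} (hx : P x u) (hy : P y v)
    (h : ∀ t, P (a t) (p t)) (t : Fin (m + 1)) :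
    P ((j.castSucc.insertNth (α := fun _ => L) x (Function.update a j y) : Fin (m + 1) → L) t)
      ((j.castSucc.insertNth (α := fun _ => α) u (Function.update p j v) : Fin (m + 1) → α) t) := by
  rcases Fin.eq_self_or_eq_succAbove j.castSucc t with rfl | ⟨s, rfl⟩
  · simpa using hx
  · rw [Fin.insertNth_apply_succAbove, Fin.insertNth_apply_succAbove]
    by_cases hs : s = j
    · subst hs; simpa using hy
    · simpa [Function.update_of_ne hs] using h s

variable {L : Type*} [AlgebraicLoop L]

theorem IsAssociatorDeviation.three_le {m : ℕ} {φ : (Fin m → L) → L}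
    (h : IsAssociatorDeviation m φ) : 3 ≤ m := by
  induction h with
  | associator => exact le_rfl
  | deviation j _ ih => omega

theorem deviation_eq {m : ℕ} (φ : (Fin m → L) → L) (j : Fin m) (a : Fin (m + 1) → L) :
    deviation φ j a =
      ldiv (φ (Function.update (fun i => a (j.castSucc.succAbove i)) j (a j.castSucc)) *
          φ (Function.update (fun i => a (j.castSucc.succAbove i)) j (a j.succ)))
        (φ (Function.update (fun i => a (j.castSucc.succAbove i)) j
          (a j.castSucc * a j.succ))) := rfl

/-- The defining equation of the deviation, solved for the value at a product. The error term has
one argument more, `x` and `y` occupying positions `j` and `j + 1`; this is why the later inductions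
run downwards on the arity. -/
theorem apply_update_mul {m : ℕ} (φ : (Fin m → L) → L) (j : Fin m) (b : Fin m → L) (x y : L) :
    φ (Function.update b j (x * y)) =
      (φ (Function.update b j x) * φ (Function.update b j y)) *
        deviation φ j (j.castSucc.insertNth (α := fun _ => L) x (Function.update b j y)) := by
  have h : ∀ i, (j.castSucc.insertNth (α := fun _ => L) x (Function.update b j y) :
      Fin (m + 1) → L) (j.castSucc.succAbove i) = Function.update b j y i :=
    fun i => Fin.insertNth_apply_succAbove (α := fun _ => L) _ _ _ _
  have h' := h j
  rw [Fin.succAbove_castSucc_self, Function.update_self] at h'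
  rw [deviation_eq, Fin.insertNth_apply_same, h']
  simp only [h, Function.update_idem]
  exact (mul_ldiv _ _).symm

theorem IsAssociatorDeviation.eq_one {m : ℕ} {φ : (Fin m → L) → L}
    (h : IsAssociatorDeviation m φ) : ∀ (a : Fin m → L) (t : Fin m), a t = 1 → φ a = 1 := by
  induction h with
  | associator =>
    intro a t ht
    rw [loopAssociator_eq_one_iff]
    fin_cases t <;> simp_all
  | @deviation m φ j _ ih =>
    intro a t ht
    rw [deviation_eq, ldiv_eq_iff, mul_one]
    rcases Fin.eq_self_or_eq_succAbove j.castSucc t with rfl | ⟨s, rfl⟩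
    · rw [ht, one_mul, ih _ j (Function.update_self _ _ _), one_mul]
    · by_cases hs : s = j
      · subst hs
        rw [Fin.succAbove_castSucc_self] at ht
        rw [ht, mul_one, ih (Function.update _ s 1) s (Function.update_self _ _ _), mul_one]
      · rw [ih _ s (by rw [Function.update_of_ne hs, ht]),
          ih _ s (by rw [Function.update_of_ne hs, ht]),
          ih _ s (by rw [Function.update_of_ne hs, ht]), one_mul]

theorem IsAssociatorDeviation.map_congr {L' : Type*} [AlgebraicLoop L'] (f : L →* L') {m : ℕ}
    {φ : (Fin m → L) → L} (h : IsAssociatorDeviation m φ) :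
    ∀ a b : Fin m → L, (∀ t, f (a t) = f (b t)) → f (φ a) = f (φ b) := by
  induction h with
  | associator =>
    intro a b hab
    simp only [map_loopAssociator, hab]
  | @deviation m φ j _ ih =>
    intro a b hab
    have key : ∀ x y : L, f x = f y →
        f (φ (Function.update (fun i => a (j.castSucc.succAbove i)) j x)) =
        f (φ (Function.update (fun i => b (j.castSucc.succAbove i)) j y)) := by
      intro x y hxy
      refine ih _ _ fun t => ?_
      by_cases ht : t = j
      · subst ht; simpa using hxy
      · simpa [Function.update_of_ne ht] using hab _
    rw [deviation_eq, deviation_eq, map_ldiv, map_ldiv, map_mul, map_mul,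
      key _ _ (hab j.castSucc), key _ _ (hab j.succ),
      key (a j.castSucc * a j.succ) (b j.castSucc * b j.succ) (by simp only [map_mul, hab])]

/-- Modulo `N` the argument in `N` may be replaced by `1`, and deviations are trivial when an
argument is `1`. -/
theorem IsAssociatorDeviation.mem_of_mem {m : ℕ} {φ : (Fin m → L) → L}
    (h : IsAssociatorDeviation m φ) {N : Set L} (hN : IsNormalSubloop N) {a : Fin m → L}
    {t : Fin m} (ht : a t ∈ N) : φ a ∈ N := by
  rw [← hN.proj_eq_one, h.map_congr hN.proj a (Function.update a t 1) fun s => ?_,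
    h.eq_one _ t (Function.update_self _ _ _), map_one]
  by_cases hs : s = t
  · subst hs
    rw [Function.update_self, map_one]
    exact hN.proj_eq_one.2 ht
  · rw [Function.update_of_ne hs]

theorem IsNormalSubloop.loopCommutator_mem_iff {N : Set L} (hN : IsNormalSubloop N) {a b : L} :
    loopCommutator a b ∈ N ↔ hN.proj a * hN.proj b = hN.proj b * hN.proj a := by
  rw [← hN.proj_eq_one, map_loopCommutator, loopCommutator_eq_one_iff]

theorem IsNormalSubloop.loopAssociator_mem_iff {N : Set L} (hN : IsNormalSubloop N) {a b c : L} :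
    loopAssociator a b c ∈ N ↔
      (hN.proj a * hN.proj b) * hN.proj c = hN.proj a * (hN.proj b * hN.proj c) := by
  rw [← hN.proj_eq_one, map_loopAssociator, loopAssociator_eq_one_iff]

theorem sum_insertNth_update {m : ℕ} (p : Fin m → ℕ) (j : Fin m) (u v : ℕ) :
    ∑ t, (j.castSucc.insertNth (α := fun _ => ℕ) u (Function.update p j v) : Fin (m + 1) → ℕ) t =
      u + ∑ t, Function.update p j v t := by
  rw [Fin.sum_univ_succAbove _ j.castSucc]
  simp

end Deviations

/-! ### Filtrations, and `gamma` as an example. -/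

section Filtrations

variable {L : Type*} [AlgebraicLoop L]

/-- A descending filtration by normal subloops that is compatible with commutators, associators
and associator deviations. -/
structure IsFiltration (Φ : ℕ → Set L) : Prop where
  normal : ∀ i, IsNormalSubloop (Φ i)
  anti : Antitone Φ
  one_eq : Φ 1 = Set.univ
  comm : ∀ {p q : ℕ} {a b : L}, 1 ≤ p → 1 ≤ q → a ∈ Φ p → b ∈ Φ q → loopCommutator a b ∈ Φ (p + q)
  dev : ∀ {m : ℕ} {φ : (Fin m → L) → L} {p : Fin m → ℕ} {a : Fin m → L},
    IsAssociatorDeviation m φ → (∀ j, 1 ≤ p j) → (∀ j, a j ∈ Φ (p j)) → φ a ∈ Φ (∑ j, p j)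

namespace IsFiltration

variable {Φ : ℕ → Set L}

theorem mem_one (hΦ : IsFiltration Φ) (a : L) : a ∈ Φ 1 := by rw [hΦ.one_eq]; trivial

theorem mem_zero (hΦ : IsFiltration Φ) (a : L) : a ∈ Φ 0 := hΦ.anti zero_le_one (hΦ.mem_one a)

theorem assoc (hΦ : IsFiltration Φ) {p q r : ℕ} {a b c : L} (hp : 1 ≤ p) (hq : 1 ≤ q)
    (hr : 1 ≤ r) (ha : a ∈ Φ p)
    (hb : b ∈ Φ q) (hc : c ∈ Φ r) : loopAssociator a b c ∈ Φ (p + q + r) := by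
  have := hΦ.dev (p := ![p, q, r]) (a := ![a, b, c]) .associator
    (by intro j; fin_cases j <;> simpa) (by intro j; fin_cases j <;> simpa)
  simpa [Fin.sum_univ_three] using this

theorem isCentral_proj (hΦ : IsFiltration Φ) {i : ℕ} (hi : 1 ≤ i) {z : L} (hz : z ∈ Φ i) :
    IsCentral ((hΦ.normal (i + 1)).proj z) :=
  (hΦ.normal (i + 1)).isCentral_proj
    (fun x => hΦ.comm hi le_rfl hz (hΦ.mem_one x))
    (fun x y => hΦ.anti (by omega : i + 1 ≤ i + 1 + 1)
      (hΦ.assoc hi le_rfl le_rfl hz (hΦ.mem_one x) (hΦ.mem_one y)))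
    (fun x y => hΦ.anti (by omega : i + 1 ≤ 1 + i + 1)
      (hΦ.assoc le_rfl hi le_rfl (hΦ.mem_one x) hz (hΦ.mem_one y)))
    (fun x y => hΦ.anti (by omega : i + 1 ≤ 1 + 1 + i)
      (hΦ.assoc le_rfl le_rfl hi (hΦ.mem_one x) (hΦ.mem_one y) hz))

theorem isCentral_of_eq_one (hΦ : IsFiltration Φ) {i : ℕ} (hi : 1 ≤ i) (h : Φ (i + 1) = {1})
    {z : L} (hz : z ∈ Φ i) :
    IsCentral z := by
  have inj : Function.Injective (hΦ.normal (i + 1)).proj := by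
    intro a b hab
    obtain ⟨n, hn, rfl⟩ := (hΦ.normal (i + 1)).proj_eq_proj.1 hab
    rw [h] at hn
    rw [Set.mem_singleton_iff.1 hn, mul_one]
  have hc := hΦ.isCentral_proj hi hz
  exact ⟨fun x => inj (by simpa using hc.comm _), fun x y => inj (by simpa using hc.left _ _),
    fun x y => inj (by simpa using hc.mid _ _), fun x y => inj (by simpa using hc.right _ _)⟩

end IsFiltration

theorem gamma_of_le_one {i : ℕ} (hi : i ≤ 1) : gamma L i = Set.univ := by
  rw [gamma, if_pos hi]

theorem gamma_of_two_le {i : ℕ} (hi : 2 ≤ i) : gamma L i = normalClosure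
    ({z | ∃ p q : Fin i, 1 ≤ p.val ∧ 1 ≤ q.val ∧ i ≤ p.val + q.val ∧
        ∃ a ∈ gamma L p.val, ∃ b ∈ gamma L q.val, z = loopCommutator a b} ∪
     {z | ∃ (m : ℕ) (φ : (Fin m → L) → L) (p : Fin m → Fin i) (a : Fin m → L),
        IsAssociatorDeviation m φ ∧ (∀ j, 1 ≤ (p j).val) ∧ i ≤ ∑ j, (p j).val ∧
        (∀ j, a j ∈ gamma L (p j).val) ∧ z = φ a}) := by
  rw [gamma, if_neg (by omega)]

theorem isNormalSubloop_gamma (i : ℕ) : IsNormalSubloop (gamma L i) := by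
  rcases Nat.lt_or_ge i 2 with hi | hi
  · rw [gamma_of_le_one (by omega)]
    exact isNormalSubloop_univ
  · rw [gamma_of_two_le hi]
    exact isNormalSubloop_normalClosure _

theorem antitone_gamma : Antitone (gamma L) := by
  refine antitone_nat_of_succ_le fun i => ?_
  rcases Nat.lt_or_ge i 2 with hi | hi
  · rw [gamma_of_le_one (by omega : i ≤ 1)]
    exact Set.subset_univ _
  · have hN := isNormalSubloop_gamma (L := L) i
    rw [gamma_of_two_le (by omega : 2 ≤ i + 1)]
    refine normalClosure_subset hN ?_
    rintro z (⟨p, q, hp, hq, hpq, a, ha, b, hb, rfl⟩ | ⟨m, φ, p, a, hφ, hp, hpi, ha, rfl⟩)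
    -- An index used for `gamma L (i + 1)` may equal `i`, which is not allowed for `gamma L i`. An
    -- argument with that index is trivial modulo `gamma L i`, hence so is the value.
    · by_cases hpi : p.val = i
      · rw [hN.loopCommutator_mem_iff, hN.proj_eq_one.2 (hpi ▸ ha), one_mul, mul_one]
      by_cases hqi : q.val = i
      · rw [hN.loopCommutator_mem_iff, (hN.proj_eq_one (a := b)).2 (hqi ▸ hb), one_mul, mul_one]
      rw [gamma_of_two_le hi]
      exact subset_normalClosure _ (Or.inl ⟨⟨p, by omega⟩, ⟨q, by omega⟩, hp, hq,
        (by omega : i ≤ p.val + q.val), a, ha, b, hb, rfl⟩)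
    · by_cases h : ∃ j, (p j).val = i
      · obtain ⟨j, hj⟩ := h
        exact hφ.mem_of_mem hN (t := j) (hj ▸ ha j)
      · push Not at h
        rw [gamma_of_two_le hi]
        exact subset_normalClosure _ (Or.inr ⟨m, φ, fun j => ⟨p j, by have := h j; omega⟩, a, hφ,
          hp, (by omega : i ≤ ∑ j, (p j).val), ha, rfl⟩)

theorem isFiltration_gamma : IsFiltration (gamma L) where
  normal := isNormalSubloop_gamma
  anti := antitone_gamma
  one_eq := gamma_of_le_one le_rfl
  comm {p q a b} hp hq ha hb := by
    rw [gamma_of_two_le (by omega)]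
    refine subset_normalClosure _ (Or.inl ?_)
    exact ⟨⟨p, by omega⟩, ⟨q, by omega⟩, hp, hq, le_refl (p + q), _, ha, _, hb, rfl⟩
  dev {m φ p a} hφ hp ha := by
    have hm := hφ.three_le
    -- There are at least three weights, all positive, so each is smaller than the sum and fits the
    -- bounded indices in the definition of `gamma`.
    have hlt : ∀ j, p j < ∑ j, p j := by
      intro j
      obtain ⟨t, ht⟩ : ∃ t : Fin m, t ≠ j := by
        have : Nontrivial (Fin m) := Fin.nontrivial_iff_two_le.2 (by omega)
        exact exists_ne j
      exact Finset.single_lt_sum ht (Finset.mem_univ _) (Finset.mem_univ _) (hp t)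
        (fun _ _ _ => Nat.zero_le _)
    have h2 : 2 ≤ ∑ j, p j := by
      have := hlt ⟨0, by omega⟩
      have := hp ⟨0, by omega⟩
      omega
    rw [gamma_of_two_le h2]
    exact subset_normalClosure _ (Or.inr ⟨m, φ, fun j => ⟨p j, hlt j⟩, a, hφ, hp, le_rfl,
      ha, rfl⟩)

end Filtrations

/-! ### Torsion, isolators, and the passage to torsion-free quotients. -/

section Powers

variable {L : Type*} [AlgebraicLoop L]

/-- Right-normed powers. -/
def rpow (g : L) : ℕ → L
  | 0 => 1
  | N + 1 => g * rpow g N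

theorem map_rpow {L' : Type*} [AlgebraicLoop L'] (f : L →* L') (g : L) (N : ℕ) :
    f (rpow g N) = rpow (f g) N := by
  induction N with
  | zero => exact map_one f
  | succ N ih => rw [rpow, map_mul, ih, rpow]

theorem Center.val_pow (z : Center L) (N : ℕ) : (z ^ N).val = rpow z.val N := by
  induction N with
  | zero => exact map_one _
  | succ N ih => rw [pow_succ', map_mul, ih, rpow]

theorem IsSubloop.rpow_mem {S : Set L} (hS : IsSubloop S) {g : L} (hg : g ∈ S) (N : ℕ) :
    rpow g N ∈ S := by
  induction N with
  | zero => exact hS.one_mem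
  | succ N ih => exact hS.mul_mem hg ih

/-- The subloop generated by a central element lies in a cyclic group, which is finite as soon as
some positive power of the element is trivial. -/
theorem eq_one_of_isCentral (htf : IsTorsionFree L) {g : L} (hg : IsCentral g) {N : ℕ}
    (hN : 0 < N) (h : rpow g N = 1) : g = 1 := by
  obtain ⟨z, rfl⟩ := exists_center hg
  by_contra hne
  have hz : IsOfFinOrder z := isOfFinOrder_iff_pow_eq_one.2 ⟨N, hN,
    Center.val_injective (by rw [Center.val_pow, h, map_one])⟩
  refine htf _ hne ?_
  have hsub : IsSubloop (Center.val '' (Subgroup.zpowers z : Set (Center L))) := by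
    refine ⟨⟨1, one_mem _, map_one _⟩, ?_, ?_, ?_⟩
    · rintro _ _ ⟨a, ha, rfl⟩ ⟨b, hb, rfl⟩
      exact ⟨a * b, mul_mem ha hb, map_mul _ _ _⟩
    · rintro _ _ ⟨a, ha, rfl⟩ ⟨b, hb, rfl⟩
      exact ⟨a⁻¹ * b, mul_mem (inv_mem ha) hb, Center.val_inv_mul _ _⟩
    · rintro _ _ ⟨a, ha, rfl⟩ ⟨b, hb, rfl⟩
      exact ⟨a * b⁻¹, mul_mem ha (inv_mem hb), Center.val_mul_inv _ _⟩
  refine (Set.Finite.image _ hz.finite_zpowers).subset (subloopClosure_subset hsub ?_)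
  rintro _ rfl
  exact ⟨z, Subgroup.mem_zpowers z, rfl⟩

end Powers

section Isolation

variable {L : Type*} [AlgebraicLoop L]

/-- The quotients `Φ i / Φ (i + 1)`, for `1 ≤ i ≤ n`, are torsion-free. -/
def IsIsolated (Φ : ℕ → Set L) (n : ℕ) : Prop :=
  ∀ i, 1 ≤ i → i ≤ n → ∀ g ∈ Φ i, ∀ N, 0 < N → rpow g N ∈ Φ (i + 1) → g ∈ Φ (i + 1)

/-- The isolator of `Φ (i + 1)` in `Φ i`. -/
def isolator (Φ : ℕ → Set L) (i : ℕ) : Set L :=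
  {g | g ∈ Φ i ∧ ∃ N, 0 < N ∧ rpow g N ∈ Φ (i + 1)}

namespace IsFiltration

variable {Φ : ℕ → Set L}

theorem subset_isolator (hΦ : IsFiltration Φ) (i : ℕ) : Φ (i + 1) ⊆ isolator Φ i :=
  fun g hg => ⟨hΦ.anti (Nat.le_succ i) hg, 1, one_pos, by simpa [rpow] using hg⟩

theorem mem_isolator_iff (hΦ : IsFiltration Φ) {i : ℕ} {z : Center (hΦ.normal (i + 1)).Quotient}
    {g : L} (hz : (hΦ.normal (i + 1)).proj g = z.val) :
    g ∈ isolator Φ i ↔ g ∈ Φ i ∧ z ∈ CommGroup.torsion (Center (hΦ.normal (i + 1)).Quotient) := by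
  refine and_congr_right fun _ => ?_
  rw [CommGroup.mem_torsion, isOfFinOrder_iff_pow_eq_one]
  refine exists_congr fun N => and_congr_right fun _ => ?_
  rw [← (hΦ.normal (i + 1)).proj_eq_one, map_rpow, hz, ← Center.val_pow, ← map_one Center.val,
    Center.val_injective.eq_iff]

theorem isSubloop_isolator (hΦ : IsFiltration Φ) {i : ℕ} (hi : 1 ≤ i) :
    IsSubloop (isolator Φ i) := by
  have hN := (hΦ.normal i)
  refine ⟨hΦ.subset_isolator i (hΦ.normal _).one_mem, ?_, ?_, ?_⟩ <;> intro a b ha hb <;>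
    obtain ⟨z, hz⟩ := exists_center (hΦ.isCentral_proj hi ha.1) <;>
    obtain ⟨w, hw⟩ := exists_center (hΦ.isCentral_proj hi hb.1) <;>
    have ha' := (hΦ.mem_isolator_iff hz.symm).1 ha <;>
    have hb' := (hΦ.mem_isolator_iff hw.symm).1 hb
  · exact (hΦ.mem_isolator_iff (z := z * w) (by rw [map_mul, map_mul, hz, hw])).2
      ⟨hN.mul_mem ha.1 hb.1, mul_mem ha'.2 hb'.2⟩
  · exact (hΦ.mem_isolator_iff (z := z⁻¹ * w) (by rw [map_ldiv, Center.val_inv_mul, hz, hw])).2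
      ⟨hN.ldiv_mem ha.1 hb.1, mul_mem (inv_mem ha'.2) hb'.2⟩
  · exact (hΦ.mem_isolator_iff (z := z * w⁻¹) (by rw [map_rdiv, Center.val_mul_inv, hz, hw])).2
      ⟨hN.rdiv_mem ha.1 hb.1, mul_mem ha'.2 (inv_mem hb'.2)⟩

/-- A subloop between two consecutive terms of a filtration is normal. -/
theorem isNormalSubloop_of_between (hΦ : IsFiltration Φ) {i : ℕ} (hi : 1 ≤ i) {S : Set L}
    (hS : IsSubloop S) (h1 : Φ (i + 1) ⊆ S) (h2 : S ⊆ Φ i) : IsNormalSubloop S :=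
  hS.isNormalSubloop_of_central (hΦ.normal (i + 1)) h1 fun _ ha => hΦ.isCentral_proj hi (h2 ha)

/-- An operation that is multiplicative modulo `N` and maps a power of `g` to `N` maps `g` to `N`,
if `N` is isolated. -/
theorem mem_of_map_rpow_mem {N T : Set L} (hN : IsNormalSubloop N) (hT : IsSubloop T)
    {h : L → L} (h1 : h 1 ∈ N) (hmul : ∀ x ∈ T, ∀ y ∈ T, hN.proj (h (x * y)) =
      hN.proj (h x) * hN.proj (h y)) {g : L} (hg : g ∈ T) {n : ℕ} (hn : h (rpow g n) ∈ N)
    (hiso : rpow (h g) n ∈ N → h g ∈ N) : h g ∈ N := by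
  refine hiso ?_
  have key : ∀ k, hN.proj (h (rpow g k)) = hN.proj (rpow (h g) k) := by
    intro k
    induction k with
    | zero => rw [rpow, rpow, map_one, hN.proj_eq_one]; exact h1
    | succ k ih => rw [rpow, rpow, hmul _ hg _ (hT.rpow_mem hg k), ih, map_mul]
  rw [← hN.proj_eq_one, ← key, hN.proj_eq_one]
  exact hn

variable {n i : ℕ}

theorem update_isolator_cases {p : ℕ} {g : L}
    (hg : g ∈ Function.update Φ (i + 1) (isolator Φ i) p) :
    g ∈ Φ p ∨ p = i + 1 ∧ g ∈ isolator Φ i := by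
  by_cases hp : p = i + 1
  · subst hp
    exact Or.inr ⟨rfl, by simpa using hg⟩
  · rw [Function.update_of_ne hp] at hg
    exact Or.inl hg

theorem subset_update_isolator (hΦ : IsFiltration Φ) (p : ℕ) :
    Φ p ⊆ Function.update Φ (i + 1) (isolator Φ i) p := by
  by_cases hp : p = i + 1
  · subst hp
    rw [Function.update_self]
    exact hΦ.subset_isolator i
  · rw [Function.update_of_ne hp]

theorem isolated_of_lt (hΦ : IsFiltration Φ) (hn : Φ (n + 1) = {1})
    (hiso : ∀ j, i < j → j ≤ n → ∀ g ∈ Φ j, ∀ N, 0 < N → rpow g N ∈ Φ (j + 1) → g ∈ Φ (j + 1))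
    {j : ℕ} (hj : i < j) {g : L} (hg : g ∈ Φ j) {N : ℕ} (hN : 0 < N)
    (h : rpow g N ∈ Φ (j + 1)) : g ∈ Φ (j + 1) := by
  rcases Nat.lt_or_ge n j with hnj | hnj
  · have : g ∈ Φ (n + 1) := hΦ.anti hnj hg
    rw [hn, Set.mem_singleton_iff] at this
    rw [this]
    exact (hΦ.normal _).one_mem
  · exact hiso j hj hnj g hg N hN h

/-- The values lie in the old term `Φ W`, which is more than a filtration needs and is what makes
the induction on `W` work. In an argument from the isolator the operation is multiplicative modulo
`Φ (W + 1)`, and a power of that argument lies in `Φ (i + 1)`; so a power of the value lies in `Φ (W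
+ 1)`, and torsion-freeness of `Φ W / Φ (W + 1)` finishes. -/
theorem dev_update_isolator (hΦ : IsFiltration Φ) (hn : Φ (n + 1) = {1}) (hi : 1 ≤ i)
    (hiso : ∀ j, i < j → j ≤ n → ∀ g ∈ Φ j, ∀ N, 0 < N → rpow g N ∈ Φ (j + 1) → g ∈ Φ (j + 1))
    (W : ℕ) : ∀ {m : ℕ} {φ : (Fin m → L) → L} {p : Fin m → ℕ} {a : Fin m → L},
      IsAssociatorDeviation m φ → (∀ j, 1 ≤ p j) →
      (∀ j, a j ∈ Function.update Φ (i + 1) (isolator Φ i) (p j)) → W ≤ ∑ j, p j → φ a ∈ Φ W := by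
  induction W with
  | zero => exact fun _ _ _ _ => hΦ.mem_zero _
  | succ W ihW =>
    -- Two inner inductions: downwards on the arity `m`, since operations in more than `n` arguments
    -- are trivial, and on a set `A` containing the positions whose arguments may fail to lie in `Φ
    -- (p j)`.
    suffices H : ∀ d m : ℕ, n + 1 ≤ m + d → ∀ {φ : (Fin m → L) → L},
        IsAssociatorDeviation m φ → ∀ A : Finset (Fin m), ∀ (p : Fin m → ℕ) (a : Fin m → L),
        (∀ j, 1 ≤ p j) → (∀ j, a j ∈ Function.update Φ (i + 1) (isolator Φ i) (p j)) →
        (∀ j ∉ A, a j ∈ Φ (p j)) → W + 1 ≤ ∑ j, p j → φ a ∈ Φ (W + 1) by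
      intro m φ p a hφ hp ha hW
      exact H (n + 1) m (by omega) hφ Finset.univ p a hp ha (by simp) hW
    intro d
    induction d with
    | zero =>
      intro m hm φ hφ A p a hp ha _ hW
      have h1 := hΦ.dev (p := fun _ => 1) (a := a) hφ (fun _ => le_rfl)
        (fun j => hΦ.mem_one (a j))
      have := hΦ.anti (by simp; omega : n + 1 ≤ ∑ _j : Fin m, 1) h1
      rw [hn, Set.mem_singleton_iff] at this
      rw [this]
      exact (hΦ.normal _).one_mem
    | succ d ihd =>
      intro m hm φ hφ A
      induction A using Finset.induction_on with
      | empty =>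
        intro p a hp _ ha hW
        exact hΦ.anti hW (hΦ.dev hφ hp fun j => ha j (by simp))
      | insert t A htA ihA =>
        intro p a hp ha haA hW
        by_cases hgood : a t ∈ Φ (p t)
        · refine ihA p a hp ha (fun j hj => ?_) hW
          by_cases hjt : j = t
          · exact hjt ▸ hgood
          · exact haA j (by simp [hjt, hj])
        obtain ⟨hpt, hat⟩ := (update_isolator_cases (ha t)).resolve_left hgood
        -- The isolator is contained in `Φ i`, so lowering the weight at `t` by one makes this
        -- argument an ordinary one.
        set p' := Function.update p t i with hp'
        have hsum : ∑ j, p' j + 1 = ∑ j, p j := by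
          rw [hp', Finset.sum_update_of_mem (Finset.mem_univ t),
            ← Finset.add_sum_erase Finset.univ p (Finset.mem_univ t), hpt,
            Finset.sdiff_singleton_eq_erase]
          ring
        have hp1 : ∀ j, 1 ≤ p' j := fun j => by
          by_cases hj : j = t
          · subst hj; simpa [hp'] using hi
          · simpa [hp', Function.update_of_ne hj] using hp j
        have ha' : ∀ j, a j ∈ Function.update Φ (i + 1) (isolator Φ i) (p' j) := fun j => by
          by_cases hj : j = t
          · subst hj
            rw [hp', Function.update_self]
            exact hΦ.subset_update_isolator i hat.1
          · rw [hp', Function.update_of_ne hj]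
            exact ha j
        by_cases hW' : W + 1 ≤ ∑ j, p' j
        · refine ihA p' a hp1 ha' (fun j hj => ?_) hW'
          by_cases hjt : j = t
          · subst hjt
            rw [hp', Function.update_self]
            exact hat.1
          · rw [hp', Function.update_of_ne hjt]
            exact haA j (by simp [hjt, hj])
        -- In the remaining case the lowered weights add up to exactly `W`. One of them is `i` and
        -- there are others, so `Φ W / Φ (W + 1)` is among the quotients known to be torsion-free.
        have hiW : i < W := by
          have hm3 := hφ.three_le
          obtain ⟨s, hs⟩ : ∃ s : Fin m, s ≠ t := by
            have : Nontrivial (Fin m) := Fin.nontrivial_iff_two_le.2 (by omega)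
            exact exists_ne t
          have := Finset.single_lt_sum (f := p') hs (Finset.mem_univ _) (Finset.mem_univ _)
            (hp1 s) (fun _ _ _ => Nat.zero_le _)
          have hpt' : p' t = i := by rw [hp', Function.update_self]
          omega
        have hT := hΦ.isSubloop_isolator hi
        have hN := hΦ.normal (W + 1)
        have hupd : ∀ x ∈ isolator Φ i, ∀ j,
            Function.update a t x j ∈ Function.update Φ (i + 1) (isolator Φ i) (p j) := by
          intro x hx j
          by_cases hj : j = t
          · subst hj
            rwa [Function.update_self, hpt, Function.update_self]
          · rw [Function.update_of_ne hj]
            exact ha j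
        have hhon : ∀ x ∈ Φ (i + 1), φ (Function.update a t x) ∈ Φ (W + 1) := by
          intro x hx
          refine ihA p _ hp (hupd x (hΦ.subset_isolator i hx)) (fun j hj => ?_) hW
          by_cases hjt : j = t
          · subst hjt
            rwa [Function.update_self, hpt]
          · rw [Function.update_of_ne hjt]
            exact haA j (by simp [hjt, hj])
        obtain ⟨N, hN0, hNg⟩ := hat.2
        have hfin := mem_of_map_rpow_mem hN hT (h := fun x => φ (Function.update a t x))
          (hhon 1 (hΦ.normal _).one_mem) ?_ hat (n := N) (hhon _ hNg) ?_
        · simpa using hfin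
        · intro x hx y hy
          have hT' : isolator Φ i = Function.update Φ (i + 1) (isolator Φ i) (i + 1) := by simp
          rw [apply_update_mul φ, map_mul, map_mul]
          refine (congrArg _ (hN.proj_eq_one.2 ?_)).trans (mul_one _)
          -- Both new arguments may lie outside `Φ (i + 1)`, so the full set of positions is needed;
          -- the induction on the arity allows it.
          refine ihd (m + 1) (by omega) (hφ.deviation t) Finset.univ
            (t.castSucc.insertNth (α := fun _ => ℕ) (i + 1) (Function.update p t (i + 1))) _ ?_ ?_
            (by simp) ?_
          · exact forall_insertNth_update (L := L) (fun _ u => 1 ≤ u) a p t (x := x) (y := y)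
              (by omega) (by omega) hp
          · exact forall_insertNth_update
              (fun g u => g ∈ Function.update Φ (i + 1) (isolator Φ i) u) a p t
              (hT' ▸ hx) (hT' ▸ hy) ha
          · rw [sum_insertNth_update, ← hpt, Function.update_eq_self]
            omega
        · intro h
          refine hΦ.isolated_of_lt hn hiso hiW ?_ hN0 h
          simpa using ihW hφ hp1 ha' (by omega)

/-- In the quotient, `b` is moved leftwards past `y` and then past `x`. The three associators
justify the rebracketing, and the two commutators that appear are central and can be collected on
the right. -/
theorem proj_loopCommutator_mul {N : Set L} (hN : IsNormalSubloop N) {x y b : L}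
    (hx : IsCentral (hN.proj (loopCommutator x b))) (hy : IsCentral (hN.proj (loopCommutator y b)))
    (h1 : loopAssociator x y b ∈ N) (h2 : loopAssociator x b y ∈ N)
    (h3 : loopAssociator b x y ∈ N) :
    hN.proj (loopCommutator (x * y) b) =
      hN.proj (loopCommutator x b) * hN.proj (loopCommutator y b) := by
  rw [hN.loopAssociator_mem_iff] at h1 h2 h3
  have ex : hN.proj x * hN.proj b =
      (hN.proj b * hN.proj x) * hN.proj (loopCommutator x b) := by
    rw [map_loopCommutator, loopCommutator, mul_ldiv]
  have ey : hN.proj y * hN.proj b =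
      (hN.proj b * hN.proj y) * hN.proj (loopCommutator y b) := by
    rw [map_loopCommutator, loopCommutator, mul_ldiv]
  rw [map_loopCommutator, loopCommutator, ldiv_eq_iff, map_mul, h1, ey, ← hy.right, ← h2, ex,
    hx.mid, hx.comm, ← hx.right, h3, hy.right]

/-- The same argument as for deviations. Multiplicativity modulo `Φ (W + 1)` now comes from
`proj_loopCommutator_mul`: the commutators lie in `Φ W` by induction, hence are central there, and
the associators are covered by `dev_update_isolator`. -/
theorem comm_update_isolator (hΦ : IsFiltration Φ) (hn : Φ (n + 1) = {1}) (hi : 1 ≤ i)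
    (hiso : ∀ j, i < j → j ≤ n → ∀ g ∈ Φ j, ∀ N, 0 < N → rpow g N ∈ Φ (j + 1) → g ∈ Φ (j + 1))
    (W : ℕ) : ∀ {p q : ℕ} {a b : L}, 1 ≤ p → 1 ≤ q →
      a ∈ Function.update Φ (i + 1) (isolator Φ i) p →
      b ∈ Function.update Φ (i + 1) (isolator Φ i) q → W ≤ p + q → loopCommutator a b ∈ Φ W := by
  induction W with
  | zero => exact fun _ _ _ _ _ => hΦ.mem_zero _
  | succ W ih =>
    have hT' : isolator Φ i = Function.update Φ (i + 1) (isolator Φ i) (i + 1) := by simp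
    have hN := hΦ.normal (W + 1)
    have key : ∀ {p q : ℕ} {a b : L}, 1 ≤ p → 1 ≤ q →
        a ∈ Function.update Φ (i + 1) (isolator Φ i) p →
        b ∈ Function.update Φ (i + 1) (isolator Φ i) q → W + 1 ≤ p + q →
        (∀ {r : ℕ} {x : L}, 1 ≤ r → x ∈ Φ r → W + 1 ≤ r + q →
          loopCommutator x b ∈ Φ (W + 1)) → loopCommutator a b ∈ Φ (W + 1) := by
      intro p q a b hp hq ha hb hW hhon
      rcases update_isolator_cases ha with ha' | ⟨rfl, ha'⟩
      · exact hhon hp ha' hW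
      by_cases hW' : W + 1 ≤ i + q
      · exact hhon hi ha'.1 hW'
      have hWeq : W = i + q := by omega
      have hmem : ∀ x ∈ isolator Φ i, loopCommutator x b ∈ Φ W := fun x hx =>
        ih hi hq (hΦ.subset_update_isolator i hx.1) hb (by omega)
      have hcen : ∀ x ∈ isolator Φ i, IsCentral (hN.proj (loopCommutator x b)) := fun x hx =>
        hΦ.isCentral_proj (by omega) (hmem x hx)
      have hass : ∀ {r s t : ℕ} {x y z : L}, 1 ≤ r → 1 ≤ s → 1 ≤ t →
          x ∈ Function.update Φ (i + 1) (isolator Φ i) r →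
          y ∈ Function.update Φ (i + 1) (isolator Φ i) s →
          z ∈ Function.update Φ (i + 1) (isolator Φ i) t → W + 1 ≤ r + s + t →
          loopAssociator x y z ∈ Φ (W + 1) := by
        intro r s t x y z hr hs ht hx hy hz hsum
        have := hΦ.dev_update_isolator hn hi hiso (W + 1) (p := ![r, s, t]) (a := ![x, y, z])
          .associator (by intro j; fin_cases j <;> simpa)
          (by intro j; fin_cases j <;> simpa) (by simpa [Fin.sum_univ_three] using hsum)
        simpa using this
      obtain ⟨N, hN0, hNg⟩ := ha'.2
      refine mem_of_map_rpow_mem hN (hΦ.isSubloop_isolator hi) (h := fun x => loopCommutator x b)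
        (hhon hp (hΦ.normal _).one_mem hW) ?_ ha' (n := N) (hhon hp hNg hW)
        (hΦ.isolated_of_lt hn hiso (by omega) (hmem a ha') hN0)
      intro x hx y hy
      exact proj_loopCommutator_mul hN (hcen x hx) (hcen y hy)
        (hass hp hp hq (hT' ▸ hx) (hT' ▸ hy) hb (by omega))
        (hass hp hq hp (hT' ▸ hx) hb (hT' ▸ hy) (by omega))
        (hass hq hp hp hb (hT' ▸ hx) (hT' ▸ hy) (by omega))
    have symm : ∀ {a b : L}, loopCommutator a b ∈ Φ (W + 1) → loopCommutator b a ∈ Φ (W + 1) := by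
      intro a b h
      rw [hN.loopCommutator_mem_iff] at h ⊢
      exact h.symm
    -- The two arguments are treated one after the other: `key` upgrades the first when the second
    -- lies in `Φ q`, and then, by symmetry, when it does not.
    have half : ∀ {p q : ℕ} {a b : L}, 1 ≤ p → 1 ≤ q →
        a ∈ Function.update Φ (i + 1) (isolator Φ i) p → b ∈ Φ q → W + 1 ≤ p + q →
        loopCommutator a b ∈ Φ (W + 1) := fun hp hq ha hb hW =>
      key hp hq ha (hΦ.subset_update_isolator _ hb) hW
        fun hr hx h => hΦ.anti h (hΦ.comm hr hq hx hb)
    intro p q a b hp hq ha hb hW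
    exact key hp hq ha hb hW fun hr hx h => symm (half hq hr hb hx (by omega))

theorem update_isolator (hΦ : IsFiltration Φ) (hn : Φ (n + 1) = {1}) (hi : 1 ≤ i)
    (hiso : ∀ j, i < j → j ≤ n → ∀ g ∈ Φ j, ∀ N, 0 < N → rpow g N ∈ Φ (j + 1) → g ∈ Φ (j + 1)) :
    IsFiltration (Function.update Φ (i + 1) (isolator Φ i)) where
  normal j := by
    by_cases hj : j = i + 1
    · subst hj
      rw [Function.update_self]
      exact hΦ.isNormalSubloop_of_between hi (hΦ.isSubloop_isolator hi) (hΦ.subset_isolator i)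
        fun _ hg => hg.1
    · rw [Function.update_of_ne hj]
      exact hΦ.normal j
  anti := by
    refine antitone_nat_of_succ_le fun j => ?_
    intro g hg
    rcases update_isolator_cases hg with hg | ⟨hj, hg⟩
    · exact hΦ.subset_update_isolator j (hΦ.anti (Nat.le_succ j) hg)
    · obtain rfl : j = i := by omega
      exact hΦ.subset_update_isolator j hg.1
  one_eq := by
    rw [Function.update_of_ne (by omega)]
    exact hΦ.one_eq
  comm hp hq ha hb := hΦ.subset_update_isolator _
    (hΦ.comm_update_isolator hn hi hiso _ hp hq ha hb le_rfl)
  dev hφ hp ha := hΦ.subset_update_isolator _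
    (hΦ.dev_update_isolator hn hi hiso _ hφ hp ha le_rfl)

/-- The union of a chain of filtrations. -/
theorem iUnion_chain {c : Set (ℕ → Set L)} (hc : ∀ Ψ ∈ c, IsFiltration Ψ)
    (hchain : IsChain (· ≤ ·) c) (hne : c.Nonempty) :
    IsFiltration (fun i => {g | ∃ Ψ ∈ c, g ∈ Ψ i}) := by
  obtain ⟨Ψ₀, hΨ₀⟩ := hne
  have two : ∀ {p q : ℕ} {a b : L}, (∃ Ψ ∈ c, a ∈ Ψ p) → (∃ Ψ ∈ c, b ∈ Ψ q) →
      ∃ Ψ ∈ c, a ∈ Ψ p ∧ b ∈ Ψ q := by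
    rintro p q a b ⟨Ψ₁, h₁, ha⟩ ⟨Ψ₂, h₂, hb⟩
    rcases hchain.total h₁ h₂ with h | h
    · exact ⟨Ψ₂, h₂, h p ha, hb⟩
    · exact ⟨Ψ₁, h₁, ha, h q hb⟩
  refine ⟨fun i => ?_, ?_, ?_, ?_, ?_⟩
  · refine isNormalSubloop_iff.2 ⟨⟨⟨Ψ₀, hΨ₀, ((hc _ hΨ₀).normal i).one_mem⟩, ?_, ?_, ?_⟩, ?_⟩
    · intro a b ha hb
      obtain ⟨Ψ, h, ha, hb⟩ := two ha hb
      exact ⟨Ψ, h, ((hc _ h).normal i).mul_mem ha hb⟩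
    · intro a b ha hb
      obtain ⟨Ψ, h, ha, hb⟩ := two ha hb
      exact ⟨Ψ, h, ((hc _ h).normal i).ldiv_mem ha hb⟩
    · intro a b ha hb
      obtain ⟨Ψ, h, ha, hb⟩ := two ha hb
      exact ⟨Ψ, h, ((hc _ h).normal i).rdiv_mem ha hb⟩
    · rintro a ⟨Ψ, h, ha⟩ x y
      have key := (isNormalSubloop_iff.1 ((hc _ h).normal i)).2 a ha x y
      exact ⟨⟨Ψ, h, key.1⟩, ⟨Ψ, h, key.2.1⟩, ⟨Ψ, h, key.2.2.1⟩, ⟨Ψ, h, key.2.2.2.1⟩,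
        ⟨Ψ, h, key.2.2.2.2.1⟩, ⟨Ψ, h, key.2.2.2.2.2⟩⟩
  · rintro i j hij g ⟨Ψ, h, hg⟩
    exact ⟨Ψ, h, (hc _ h).anti hij hg⟩
  · exact Set.eq_univ_of_forall fun g => ⟨Ψ₀, hΨ₀, (hc _ hΨ₀).mem_one g⟩
  · intro p q a b hp hq ha hb
    obtain ⟨Ψ, h, ha, hb⟩ := two ha hb
    exact ⟨Ψ, h, (hc _ h).comm hp hq ha hb⟩
  · intro m φ p a hφ hp ha
    have : ∀ s : Finset (Fin m), ∃ Ψ ∈ c, ∀ j ∈ s, a j ∈ Ψ (p j) := by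
      intro s
      induction s using Finset.induction_on with
      | empty => exact ⟨Ψ₀, hΨ₀, by simp⟩
      | insert t s _ ih =>
        obtain ⟨Ψ₁, h₁, hs⟩ := ih
        obtain ⟨Ψ₂, h₂, ht⟩ := ha t
        rcases hchain.total h₁ h₂ with h | h
        · exact ⟨Ψ₂, h₂, Finset.forall_mem_insert _ _ _ |>.2 ⟨ht, fun j hj => h _ (hs j hj)⟩⟩
        · exact ⟨Ψ₁, h₁, Finset.forall_mem_insert _ _ _ |>.2 ⟨h _ ht, hs⟩⟩
    obtain ⟨Ψ, h, hs⟩ := this Finset.univ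
    exact ⟨Ψ, h, (hc _ h).dev hφ hp fun j => hs j (Finset.mem_univ j)⟩

end IsFiltration

/-- A torsion-free loop with a filtration of finite length has a filtration of the same length with
torsion-free quotients. -/
theorem exists_isIsolated (htf : IsTorsionFree L) {n : ℕ} {Φ₀ : ℕ → Set L}
    (h₀ : IsFiltration Φ₀) (hn₀ : Φ₀ (n + 1) = {1}) :
    ∃ Φ : ℕ → Set L, IsFiltration Φ ∧ Φ (n + 1) = {1} ∧ IsIsolated Φ n := by
  -- Enlarging `Φ (i + 1)` may create torsion in the next quotient, so a single pass through the
  -- indices is not enough. A maximal filtration is stable under all such enlargements.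
  obtain ⟨Φ, -, hmax⟩ := zorn_le_nonempty₀
    {Φ : ℕ → Set L | IsFiltration Φ ∧ Φ (n + 1) = {1}} (fun c hcs hchain Ψ hΨ =>
      ⟨fun i => {g | ∃ Ψ ∈ c, g ∈ Ψ i},
        ⟨IsFiltration.iUnion_chain (fun Ψ h => (hcs h).1) hchain ⟨Ψ, hΨ⟩, by
          ext g
          constructor
          · rintro ⟨Ψ, h, hg⟩
            rwa [(hcs h).2] at hg
          · intro hg
            exact ⟨Ψ, hΨ, by rwa [(hcs hΨ).2]⟩⟩,
        fun Ψ h i g hg => ⟨Ψ, h, hg⟩⟩) Φ₀ ⟨h₀, hn₀⟩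
  obtain ⟨hΦ, hn⟩ := hmax.prop
  refine ⟨Φ, hΦ, hn, ?_⟩
  suffices H : ∀ d i, 1 ≤ i → i ≤ n → n ≤ i + d →
      ∀ g ∈ Φ i, ∀ N, 0 < N → rpow g N ∈ Φ (i + 1) → g ∈ Φ (i + 1) from
    fun i hi hin => H n i hi hin (by omega)
  intro d
  induction d using Nat.strong_induction_on with
  | _ d ih =>
    intro i hi hin hd g hg N hN hgN
    rcases Nat.lt_or_ge i n with hlt | hge
    · have hiso : ∀ j, i < j → j ≤ n → ∀ g ∈ Φ j, ∀ N, 0 < N → rpow g N ∈ Φ (j + 1) →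
          g ∈ Φ (j + 1) := fun j hj hjn =>
        ih (n - j) (by omega) j (by omega) hjn (by omega)
      -- Since `i < n`, the term `Φ (n + 1) = {1}` is not touched. The case `i = n` is different:
      -- there the torsion-freeness of `L` itself is used.
      have hle := hmax.le_of_ge (y := Function.update Φ (i + 1) (isolator Φ i))
        ⟨hΦ.update_isolator hn hi hiso, by rw [Function.update_of_ne (by omega), hn]⟩
        (fun p => hΦ.subset_update_isolator p)
      refine hle (i + 1) ?_
      rw [Function.update_self]
      exact ⟨hg, N, hN, hgN⟩
    · obtain rfl : i = n := by omega
      rw [hn, Set.mem_singleton_iff] at hgN ⊢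
      exact eq_one_of_isCentral htf (hΦ.isCentral_of_eq_one hi hn hg) hN hgN

end Isolation

/-! ### Commutation with nuclear elements. -/

section Nuclear

variable {L : Type*} [AlgebraicLoop L]

/-- An element that associates with all elements. -/
structure IsNuclear (z : L) : Prop where
  left : ∀ x y, (z * x) * y = z * (x * y)
  mid : ∀ x y, (x * z) * y = x * (z * y)
  right : ∀ x y, (x * y) * z = x * (y * z)

namespace IsNuclear

variable {z w x y : L}

/-- These six rules allow commutation to be checked on generators in either argument. They stand in
for bilinearity of the commutator, whose deviations a filtration does not control directly. -/
theorem comm_mul (hz : IsNuclear z) (hx : z * x = x * z) (hy : z * y = y * z) :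
    z * (x * y) = (x * y) * z := by
  rw [← hz.left, hx, hz.mid, hy, hz.right]

theorem comm_ldiv (hz : IsNuclear z) (hx : z * x = x * z) (hy : z * y = y * z) :
    z * ldiv x y = ldiv x y * z := by
  refine left_cancel (a := x) ?_
  rw [← hz.mid, ← hx, hz.left, ← hz.right, mul_ldiv, hy]

theorem comm_rdiv (hz : IsNuclear z) (hx : z * x = x * z) (hy : z * y = y * z) :
    z * rdiv y x = rdiv y x * z := by
  refine right_cancel (a := x) ?_
  rw [hz.left, rdiv_mul, hy, hz.mid, hx, ← hz.right, rdiv_mul]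

theorem mul_comm_of (hz : IsNuclear z) (hzx : z * x = x * z) (hwx : w * x = x * w) :
    (z * w) * x = x * (z * w) := by
  rw [hz.left, hwx, ← hz.left, hzx, hz.mid]

theorem ldiv_comm_of (hz : IsNuclear z) (hzx : z * x = x * z) (hwx : w * x = x * w) :
    ldiv z w * x = x * ldiv z w := by
  refine left_cancel (a := z) ?_
  rw [← hz.left, mul_ldiv, hwx, ← hz.left, hzx, hz.mid, mul_ldiv]

theorem rdiv_comm_of (hz : IsNuclear z) (hzx : z * x = x * z) (hwx : w * x = x * w) :
    rdiv w z * x = x * rdiv w z := by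
  refine right_cancel (a := z) ?_
  rw [hz.right, ← hzx, ← hz.mid, rdiv_mul, hwx, hz.right, rdiv_mul]

end IsNuclear

end Nuclear

/-! ### Cubes over a filtered loop and their filtration. -/

section Cubes

variable {L : Type*} [AlgebraicLoop L] {ι : Type}

/-- The function on the vertices of a cube that is `g` on the face given by `J` and `1` elsewhere. -/
def face (J : Finset ι) (g : L) : (ι → Bool) → L :=
  fun ω => if ∀ t ∈ J, ω t = true then g else 1

theorem face_mul (J : Finset ι) (g h : L) : face J (g * h) = face J g * face J h := by
  funext ω
  by_cases hω : ∀ t ∈ J, ω t = true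
  · simp only [face, Pi.mul_apply, if_pos hω]
  · simp only [face, Pi.mul_apply, if_neg hω, one_mul]

theorem face_ldiv (J : Finset ι) (g h : L) : face J (ldiv g h) = ldiv (face J g) (face J h) := by
  rw [eq_comm, ldiv_eq_iff, ← face_mul, mul_ldiv]

variable (ι) in
/-- The faces with values in `S`, the value on a face of codimension `j` being in `Φ j`. -/
def cubeFaces (Φ : ℕ → Set L) (S : Set L) : Set ((ι → Bool) → L) :=
  {F | ∃ (J : Finset ι) (g : L), g ∈ S ∧ g ∈ Φ J.card ∧ F = face J g}

variable (ι) in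
/-- The loop of cubes with values in `S`. -/
def cubes (Φ : ℕ → Set L) (S : Set L) : Set ((ι → Bool) → L) := subloopClosure (cubeFaces ι Φ S)

theorem isSubloop_cubes (Φ : ℕ → Set L) (S : Set L) : IsSubloop (cubes ι Φ S) :=
  isSubloop_subloopClosure _

theorem face_mem_cubes {Φ : ℕ → Set L} {S : Set L} {J : Finset ι} {g : L} (hS : g ∈ S)
    (hJ : g ∈ Φ J.card) : face J g ∈ cubes ι Φ S :=
  subset_subloopClosure _ ⟨J, g, hS, hJ, rfl⟩

theorem cubes_mono {Φ : ℕ → Set L} {S T : Set L} (h : S ⊆ T) : cubes ι Φ S ⊆ cubes ι Φ T :=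
  subloopClosure_mono fun _ ⟨J, g, hS, hJ, e⟩ => ⟨J, g, h hS, hJ, e⟩

theorem apply_mem_of_mem_cubes {Φ : ℕ → Set L} {S : Set L} (hS : IsSubloop S)
    {F : (ι → Bool) → L} (hF : F ∈ cubes ι Φ S) (ω : ι → Bool) : F ω ∈ S := by
  refine subloopClosure_induction (P := fun F => F ω ∈ S) ?_ hS.one_mem
    (fun _ _ _ _ hx hy => hS.mul_mem hx hy) (fun _ _ _ _ hx hy => hS.ldiv_mem hx hy)
    (fun _ _ _ _ hx hy => hS.rdiv_mem hx hy) hF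
  rintro _ ⟨J, g, hg, -, rfl⟩
  by_cases hω : ∀ t ∈ J, ω t = true
  · simpa only [face, if_pos hω] using hg
  · simpa only [face, if_neg hω] using hS.one_mem

/-- The pointwise extension of an operation to functions. -/
def pointwise {α κ : Type*} {m : ℕ} (φ : (Fin m → α) → α) (F : Fin m → κ → α) : κ → α :=
  fun ω => φ fun j => F j ω

theorem pointwise_update {α κ : Type*} {m : ℕ} (φ : (Fin m → α) → α) (F : Fin m → κ → α)
    (t : Fin m) (x : κ → α) (ω : κ) : pointwise φ (Function.update F t x) ω =
      φ (Function.update (fun j => F j ω) t (x ω)) := by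
  rw [pointwise]
  congr 1
  funext j
  exact Function.apply_update (fun _ (G : κ → α) => G ω) F t x j

theorem deviation_pointwise {κ : Type*} {m : ℕ} (φ : (Fin m → L) → L) (t : Fin m) :
    deviation (pointwise (κ := κ) φ) t = pointwise (deviation φ t) := by
  funext F ω
  rw [deviation_eq, pi_ldiv_apply, Pi.mul_apply, pointwise_update, pointwise_update,
    pointwise_update]
  rfl

namespace IsFiltration

variable {Φ : ℕ → Set L} {n : ℕ}

theorem eq_one_of_mem_cubes (hΦ : IsFiltration Φ) (hn : Φ (n + 1) = {1}) {m : ℕ} (hm : n + 1 ≤ m)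
    {F : (ι → Bool) → L} (hF : F ∈ cubes ι Φ (Φ m)) : F = 1 := by
  funext ω
  have := hΦ.anti hm (apply_mem_of_mem_cubes (hΦ.normal m).toIsSubloop hF ω)
  rw [hn] at this
  exact this

theorem mem_max {α : Type*} {Φ : ℕ → Set α} {p q : ℕ} {g : α} (hp : g ∈ Φ p) (hq : g ∈ Φ q) :
    g ∈ Φ (max p q) := by
  rcases le_total p q with h | h
  · rwa [max_eq_right h]
  · rwa [max_eq_left h]

/-- On faces the value is again a face. A general argument is reduced to faces by induction on its
construction, at the price of deviations of higher arity. The inner induction is on a set `A`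
outside which the arguments are faces. -/
theorem dev_cubes (hΦ : IsFiltration Φ) (hn : Φ (n + 1) = {1}) {m : ℕ} {φ : (Fin m → L) → L}
    {p : Fin m → ℕ} {F : Fin m → (ι → Bool) → L} (hφ : IsAssociatorDeviation m φ)
    (hp : ∀ j, 1 ≤ p j) (hF : ∀ j, F j ∈ cubes ι Φ (Φ (p j))) :
    pointwise φ F ∈ cubes ι Φ (Φ (∑ j, p j)) := by
  classical
  suffices H : ∀ d m : ℕ, n + 1 ≤ m + d → ∀ {φ : (Fin m → L) → L},
      IsAssociatorDeviation m φ → ∀ p : Fin m → ℕ, (∀ j, 1 ≤ p j) → ∀ A : Finset (Fin m),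
      ∀ F : Fin m → (ι → Bool) → L, (∀ j, F j ∈ cubes ι Φ (Φ (p j))) →
      (∀ j ∉ A, F j ∈ cubeFaces ι Φ (Φ (p j))) →
      pointwise φ F ∈ cubes ι Φ (Φ (∑ j, p j)) from
    H (n + 1) m (by omega) hφ p hp Finset.univ F hF (by simp)
  clear hφ hp hF
  clear F p φ m
  intro d
  induction d with
  | zero =>
    intro m hm φ hφ p hp A F hF _
    have : pointwise φ F = 1 := by
      funext ω
      have h1 := hΦ.dev (p := fun _ => 1) (a := fun j => F j ω) hφ (fun _ => le_rfl)
        (fun j => hΦ.mem_one _)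
      have := hΦ.anti (by simp; omega : n + 1 ≤ ∑ _j : Fin m, 1) h1
      rw [hn] at this
      exact this
    rw [this]
    exact (isSubloop_cubes _ _).one_mem
  | succ d ihd =>
    intro m hm φ hφ p hp A
    induction A using Finset.induction_on with
    | empty =>
      intro F _ hF
      choose J g hgp hgJ hFg using fun j => hF j (by simp)
      -- A deviation is `1` when one argument is `1`, so the value is supported on the intersection
      -- of the faces, which is the face of the union of the `J j`.
      have heq : pointwise φ F = face (Finset.univ.biUnion J) (φ g) := by
        funext ω
        by_cases hω : ∀ t ∈ Finset.univ.biUnion J, ω t = true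
        · rw [face, if_pos hω, pointwise]
          congr 1
          funext j
          rw [hFg, face, if_pos]
          exact fun t ht => hω t (Finset.mem_biUnion.2 ⟨j, Finset.mem_univ _, ht⟩)
        · rw [face, if_neg hω, pointwise]
          push Not at hω
          obtain ⟨t, ht, hωt⟩ := hω
          obtain ⟨j, -, hj⟩ := Finset.mem_biUnion.1 ht
          refine hφ.eq_one _ j ?_
          rw [hFg, face, if_neg]
          exact fun h => hωt (h t hj)
      -- The weights `max (p j) (J j).card` bound both the depth of the values and the codimension
      -- of the face, and they are positive even if `J j` is empty.
      rw [heq]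
      have := hΦ.dev (p := fun j => max (p j) (J j).card) (a := g) hφ
        (fun j => le_max_of_le_left (hp j)) (fun j => mem_max (hgp j) (hgJ j))
      refine face_mem_cubes (hΦ.anti (Finset.sum_le_sum fun j _ => le_max_left _ _) this)
        (hΦ.anti ?_ this)
      exact Finset.card_biUnion_le.trans (Finset.sum_le_sum fun j _ => le_max_right _ _)
    | insert t A htA ihA =>
      intro F hF hFA
      have hsub := isSubloop_cubes (ι := ι) Φ (Φ (∑ j, p j))
      have hupd : ∀ x ∈ cubes ι Φ (Φ (p t)), ∀ j,
          Function.update F t x j ∈ cubes ι Φ (Φ (p j)) := by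
        intro x hx j
        by_cases hj : j = t
        · subst hj
          rwa [Function.update_self]
        · rw [Function.update_of_ne hj]
          exact hF j
      have hdev : ∀ x ∈ cubes ι Φ (Φ (p t)), ∀ y ∈ cubes ι Φ (Φ (p t)),
          deviation (pointwise φ) t (t.castSucc.insertNth (α := fun _ => (ι → Bool) → L) x
            (Function.update F t y)) ∈ cubes ι Φ (Φ (∑ j, p j)) := by
        intro x hx y hy
        rw [deviation_pointwise]
        have := ihd (m + 1) (by omega) (hφ.deviation t)
          (t.castSucc.insertNth (α := fun _ => ℕ) (p t) (Function.update p t (p t)))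
          (forall_insertNth_update (L := L) (fun _ u => 1 ≤ u) 1 p t (x := 1) (y := 1)
            (hp t) (hp t) hp) Finset.univ _
          (forall_insertNth_update (fun g u => g ∈ cubes ι Φ (Φ u)) F p t hx hy hF) (by simp)
        refine cubes_mono (hΦ.anti ?_) this
        rw [sum_insertNth_update, Function.update_eq_self]
        omega
      have key : ∀ x ∈ cubes ι Φ (Φ (p t)),
          pointwise φ (Function.update F t x) ∈ cubes ι Φ (Φ (∑ j, p j)) := by
        intro x hx
        refine subloopClosure_induction
          (P := fun x => pointwise φ (Function.update F t x) ∈ cubes ι Φ (Φ (∑ j, p j)))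
          ?_ ?_ ?_ ?_ ?_ hx
        · intro x hx
          refine ihA _ (hupd x (subset_subloopClosure _ hx)) fun j hj => ?_
          by_cases hjt : j = t
          · subst hjt
            rwa [Function.update_self]
          · rw [Function.update_of_ne hjt]
            exact hFA j (by simp [hjt, hj])
        · have : pointwise φ (Function.update F t 1) = 1 := by
            funext ω
            rw [pointwise_update]
            exact hφ.eq_one _ t (Function.update_self _ _ _)
          rw [this]
          exact hsub.one_mem
        · intro x y hx hy hx' hy'
          rw [apply_update_mul (pointwise φ)]
          exact hsub.mul_mem (hsub.mul_mem hx' hy') (hdev x hx y hy)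
        · intro x y hx hy hx' hy'
          have hxy := (isSubloop_cubes _ _).ldiv_mem hx hy
          have h := apply_update_mul (pointwise φ) t F x (ldiv x y)
          rw [mul_ldiv] at h
          rw [← ldiv_eq_iff.2 (rdiv_eq_iff.2 h)]
          exact hsub.ldiv_mem hx' (hsub.rdiv_mem hy' (hdev x hx _ hxy))
        · intro x y hx hy hx' hy'
          have hxy := (isSubloop_cubes _ _).rdiv_mem hx hy
          have h := apply_update_mul (pointwise φ) t F (rdiv x y) y
          rw [rdiv_mul] at h
          rw [← rdiv_eq_iff.2 (rdiv_eq_iff.2 h)]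
          exact hsub.rdiv_mem (hsub.rdiv_mem hx' (hdev _ hxy y hy)) hy'
      have := key (F t) (hF t)
      rwa [Function.update_eq_self] at this

theorem assoc_cubes (hΦ : IsFiltration Φ) (hn : Φ (n + 1) = {1}) {p q r : ℕ}
    {F G H : (ι → Bool) → L} (hp : 1 ≤ p) (hq : 1 ≤ q) (hr : 1 ≤ r) (hF : F ∈ cubes ι Φ (Φ p))
    (hG : G ∈ cubes ι Φ (Φ q)) (hH : H ∈ cubes ι Φ (Φ r)) :
    loopAssociator F G H ∈ cubes ι Φ (Φ (p + q + r)) := by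
  have := hΦ.dev_cubes hn (p := ![p, q, r]) (F := ![F, G, H]) .associator
    (by intro j; fin_cases j <;> simpa) (by intro j; fin_cases j <;> simpa)
  rw [Fin.sum_univ_three] at this
  exact this

variable (Φ ι) in
/-- The loop of all cubes. -/
abbrev CubeLoop : Type _ := (isSubloop_cubes (ι := ι) Φ (Φ 1)).Carrier

/-- A cube, as an element of the loop of cubes. -/
def cubeElem {F : (ι → Bool) → L} (hF : F ∈ cubes ι Φ (Φ 1)) : CubeLoop ι Φ := ⟨F, hF⟩

variable (Φ ι) in
/-- The cubes with values in `Φ j`, as a subset of the loop of cubes. -/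
def cubeFiltration (j : ℕ) : Set (CubeLoop ι Φ) := {F | F.1 ∈ cubes ι Φ (Φ j)}

theorem isSubloop_cubeFiltration (j : ℕ) : IsSubloop (cubeFiltration ι Φ j) where
  one_mem := (isSubloop_cubes Φ (Φ j)).one_mem
  mul_mem ha hb := (isSubloop_cubes Φ (Φ j)).mul_mem ha hb
  ldiv_mem ha hb := (isSubloop_cubes Φ (Φ j)).ldiv_mem ha hb
  rdiv_mem ha hb := (isSubloop_cubes Φ (Φ j)).rdiv_mem ha hb

theorem loopCommutator_face_mem (hΦ : IsFiltration Φ) {j : ℕ} {z x : (ι → Bool) → L}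
    (hj : 1 ≤ j) (hz : z ∈ cubeFaces ι Φ (Φ j)) (hx : x ∈ cubeFaces ι Φ (Φ 1)) :
    loopCommutator z x ∈ cubes ι Φ (Φ (j + 1)) := by
  classical
  obtain ⟨J, g, hg, hgJ, rfl⟩ := hz
  obtain ⟨K, h, hh, hhK, rfl⟩ := hx
  have heq : loopCommutator (face J g) (face K h) = face (J ∪ K) (loopCommutator g h) := by
    funext ω
    rw [pi_loopCommutator_apply]
    by_cases hJ : ∀ t ∈ J, ω t = true
    · by_cases hK : ∀ t ∈ K, ω t = true
      · have : ∀ t ∈ J ∪ K, ω t = true := fun t ht => (Finset.mem_union.1 ht).elim (hJ t) (hK t)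
        simp only [face, if_pos hJ, if_pos hK, if_pos this]
      · have : ¬ ∀ t ∈ J ∪ K, ω t = true := fun h => hK fun t ht => h t (Finset.mem_union_right _ ht)
        simp only [face, if_neg hK, if_neg this, loopCommutator, one_mul, mul_one, ldiv_self]
    · have : ¬ ∀ t ∈ J ∪ K, ω t = true := fun h => hJ fun t ht => h t (Finset.mem_union_left _ ht)
      simp only [face, if_neg hJ, if_neg this, loopCommutator, one_mul, mul_one, ldiv_self]
  rw [heq]
  have := hΦ.comm (le_max_of_le_left hj) (le_max_left 1 _) (mem_max hg hgJ) (mem_max hh hhK)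
  refine face_mem_cubes (hΦ.anti (by omega) this) (hΦ.anti ?_ this)
  exact (Finset.card_union_le _ _).trans (by omega)

/-- Nuclearity is `assoc_cubes`. Commutation holds for faces by `loopCommutator_face_mem` and
extends first to all cubes `x`, then to all `z`. -/
theorem isCentral_proj_cubes (hΦ : IsFiltration Φ) (hn : Φ (n + 1) = {1}) {j : ℕ} (hj : 1 ≤ j)
    (hN : IsNormalSubloop (cubeFiltration ι Φ (j + 1))) {z : CubeLoop ι Φ}
    (hz : z ∈ cubeFiltration ι Φ j) : IsCentral (hN.proj z) := by
  have nuc : ∀ z ∈ cubeFiltration ι Φ j, IsNuclear (hN.proj z) := by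
    intro z hz
    refine ⟨fun x y => ?_, fun x y => ?_, fun x y => ?_⟩ <;>
      obtain ⟨x, rfl⟩ := hN.proj_surjective x <;> obtain ⟨y, rfl⟩ := hN.proj_surjective y
    · exact hN.loopAssociator_mem_iff.1 (cubes_mono (hΦ.anti (by omega : j + 1 ≤ j + 1 + 1))
        (hΦ.assoc_cubes hn hj le_rfl le_rfl hz x.2 y.2))
    · exact hN.loopAssociator_mem_iff.1 (cubes_mono (hΦ.anti (by omega : j + 1 ≤ 1 + j + 1))
        (hΦ.assoc_cubes hn le_rfl hj le_rfl x.2 hz y.2))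
    · exact hN.loopAssociator_mem_iff.1 (cubes_mono (hΦ.anti (by omega : j + 1 ≤ 1 + 1 + j))
        (hΦ.assoc_cubes hn le_rfl le_rfl hj x.2 y.2 hz))
  have sub : cubes ι Φ (Φ j) ⊆ cubes ι Φ (Φ 1) := cubes_mono (hΦ.anti hj)
  have gen : ∀ z, (hz : z ∈ cubeFaces ι Φ (Φ j)) → ∀ x, (hx : x ∈ cubes ι Φ (Φ 1)) →
      hN.proj (cubeElem (sub (subset_subloopClosure _ hz))) * hN.proj (cubeElem hx) =
        hN.proj (cubeElem hx) * hN.proj (cubeElem (sub (subset_subloopClosure _ hz))) := by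
    intro z hz x hx
    have hzn := nuc (cubeElem (sub (subset_subloopClosure _ hz))) (subset_subloopClosure _ hz)
    refine subloopClosure_induction (P := fun x => ∀ hx : x ∈ cubes ι Φ (Φ 1),
      hN.proj (cubeElem (sub (subset_subloopClosure _ hz))) * hN.proj (cubeElem hx) =
        hN.proj (cubeElem hx) * hN.proj (cubeElem (sub (subset_subloopClosure _ hz)))) ?_ ?_ ?_ ?_ ?_ hx hx
    · intro x hx hx'
      exact hN.loopCommutator_mem_iff.1 (hΦ.loopCommutator_face_mem hj hz hx)
    · intro h1
      have : hN.proj (cubeElem h1) = 1 := map_one hN.proj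
      rw [this, one_mul, mul_one]
    · intro x y hx hy hx' hy' hxy
      have := hzn.comm_mul (hx' hx) (hy' hy)
      rw [← map_mul hN.proj] at this
      exact this
    · intro x y hx hy hx' hy' hxy
      have := hzn.comm_ldiv (hx' hx) (hy' hy)
      rw [← map_ldiv hN.proj] at this
      exact this
    · intro x y hx hy hx' hy' hxy
      have := hzn.comm_rdiv (hy' hy) (hx' hx)
      rw [← map_rdiv hN.proj] at this
      exact this
  have all : ∀ x, (hx : x ∈ cubes ι Φ (Φ 1)) → ∀ z ∈ cubes ι Φ (Φ j), ∀ hz : z ∈ cubes ι Φ (Φ 1),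
      hN.proj (cubeElem hz) * hN.proj (cubeElem hx) = hN.proj (cubeElem hx) * hN.proj (cubeElem hz) := by
    intro x hx z hz
    refine subloopClosure_induction (P := fun z => ∀ hz : z ∈ cubes ι Φ (Φ 1),
      hN.proj (cubeElem hz) * hN.proj (cubeElem hx) = hN.proj (cubeElem hx) * hN.proj (cubeElem hz)) ?_ ?_ ?_ ?_ ?_ hz
    · exact fun z hz _ => gen z hz x hx
    · intro h1
      have : hN.proj (cubeElem h1) = 1 := map_one hN.proj
      rw [this, one_mul, mul_one]
    · intro z w hz hw hz' hw' _
      have := (nuc (cubeElem (sub hz)) hz).mul_comm_of (hz' (sub hz)) (hw' (sub hw))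
      rw [← map_mul hN.proj] at this
      exact this
    · intro z w hz hw hz' hw' _
      have := (nuc (cubeElem (sub hz)) hz).ldiv_comm_of (hz' (sub hz)) (hw' (sub hw))
      rw [← map_ldiv hN.proj] at this
      exact this
    · intro z w hz hw hz' hw' _
      have := (nuc (cubeElem (sub hw)) hw).rdiv_comm_of (hw' (sub hw)) (hz' (sub hz))
      rw [← map_rdiv hN.proj] at this
      exact this
  refine ⟨fun x => ?_, (nuc z hz).left, (nuc z hz).mid, (nuc z hz).right⟩
  obtain ⟨x, rfl⟩ := hN.proj_surjective x
  exact all x.1 x.2 z.1 hz z.2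

/-- Downward induction: beyond `n` the subloop is trivial, and a subloop that is central modulo the
next, normal one is normal. -/
theorem isNormalSubloop_cubeFiltration (hΦ : IsFiltration Φ) (hn : Φ (n + 1) = {1}) {j : ℕ}
    (hj : 1 ≤ j) : IsNormalSubloop (cubeFiltration ι Φ j) := by
  suffices H : ∀ d j, 1 ≤ j → n + 1 ≤ j + d → IsNormalSubloop (cubeFiltration ι Φ j) from
    H (n + 1) j hj (by omega)
  intro d
  induction d with
  | zero =>
    intro j hj hjn
    have : cubeFiltration ι Φ j = {1} := by
      ext F
      constructor
      · exact fun hF => Subtype.ext (hΦ.eq_one_of_mem_cubes hn hjn hF)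
      · rintro rfl
        exact (isSubloop_cubeFiltration j).one_mem
    rw [this]
    exact isNormalSubloop_singleton_one
  | succ d ih =>
    intro j hj hjn
    have hN := ih (j + 1) (by omega) (by omega)
    exact (isSubloop_cubeFiltration j).isNormalSubloop_of_central hN
      (fun F hF => cubes_mono (hΦ.anti (Nat.le_succ j)) hF)
      fun z hz => hΦ.isCentral_proj_cubes hn hj hN hz

end IsFiltration

end Cubes

/-! ### Retractions of cubes along cyclic extensions, and vanishing alternating sums. -/

section CyclicSteps

variable {L : Type*} [AlgebraicLoop L] {ι : Type}

namespace IsFiltration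

variable {Φ : ℕ → Set L} {n i : ℕ}

/-- A retraction of `T'` onto `T` that is invariant under multiplication by an element `x`
which generates `T'` over `T` maps cubes to cubes. -/
theorem comp_mem_cubes (hΦ : IsFiltration Φ) (hn : Φ (n + 1) = {1}) (hi : 1 ≤ i) {T T' : Set L}
    (hT : IsSubloop T) (h1 : Φ (i + 1) ⊆ T) (h2 : T' ⊆ Φ i) (hTT' : T ⊆ T') {x : L} (hx : x ∈ T')
    (hgen : ∀ X : Set L, T ⊆ X → (∀ g ∈ X, x * g ∈ X) → (∀ g ∈ X, ldiv x g ∈ X) → T' ⊆ X)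
    {ρ : L → L} (hρ : ∀ g, ρ (x * g) = ρ g) (hρT : ∀ t ∈ T, ρ t = t) {F : (ι → Bool) → L}
    (hF : F ∈ cubes ι Φ T') : (fun ω => ρ (F ω)) ∈ cubes ι Φ T := by
  have hN := hΦ.isNormalSubloop_cubeFiltration (ι := ι) hn (by omega : 1 ≤ i + 1)
  have sub : cubes ι Φ T' ⊆ cubes ι Φ (Φ 1) := cubes_mono (h2.trans (hΦ.anti hi))
  have subT : cubes ι Φ T ⊆ cubes ι Φ (Φ 1) := (cubes_mono hTT').trans sub
  have cen : ∀ F, (hF : F ∈ cubes ι Φ T') → IsCentral (hN.proj (cubeElem (sub hF))) :=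
    fun F hF => hΦ.isCentral_proj_cubes hn hi hN (cubes_mono h2 hF)
  have hξ : ∀ J : Finset ι, J.card ≤ i → face J x ∈ cubes ι Φ T' := fun J hJ =>
    face_mem_cubes hx (hΦ.anti hJ (h2 hx))
  let gens : Set (Center hN.Quotient) :=
    {z | ∃ (J : Finset ι) (hJ : J.card ≤ i), z.val = hN.proj (cubeElem (sub (hξ J hJ)))}
  let A : Subgroup (Center hN.Quotient) :=
    { carrier := {z | ∃ (a : (ι → Bool) → L) (ha : a ∈ cubes ι Φ T),
        z.val = hN.proj (cubeElem (subT ha))}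
      one_mem' := ⟨1, (isSubloop_cubes _ _).one_mem,
        (map_one _).trans (map_one hN.proj).symm⟩
      mul_mem' := by
        rintro z w ⟨a, ha, hza⟩ ⟨b, hb, hzb⟩
        refine ⟨a * b, (isSubloop_cubes _ _).mul_mem ha hb, ?_⟩
        rw [map_mul, hza, hzb, ← map_mul]
        rfl
      inv_mem' := by
        rintro z ⟨a, ha, hza⟩
        refine ⟨ldiv a 1, (isSubloop_cubes _ _).ldiv_mem ha (isSubloop_cubes _ _).one_mem, ?_⟩
        rw [Center.val_inv, hza, ← map_one hN.proj, ← map_ldiv]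
        rfl }
  -- The factors of `y` are classes of faces of `x` and their inverses. Removing one changes `F`
  -- only on a face, by multiplication or division by `x`, to which `ρ` is blind. When none is left,
  -- `F` differs from `a` by a cube with values in `Φ (i + 1) ⊆ T`, so `F` is a cube in `T` and is
  -- fixed by `ρ`.
  have claim : ∀ y ∈ Subgroup.closure gens, ∀ F, (hF : F ∈ cubes ι Φ (Φ 1)) → ∀ a,
      (ha : a ∈ cubes ι Φ T) →
      hN.proj (cubeElem hF) = y.val * hN.proj (cubeElem (subT ha)) →
      (fun ω => ρ (F ω)) ∈ cubes ι Φ T := by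
    intro y hy
    induction hy using Subgroup.closure_induction_left with
    | one =>
      intro F hF a ha h
      rw [map_one, one_mul] at h
      obtain ⟨m, hm, hFm⟩ := hN.proj_eq_proj.1 h.symm
      have hFT : F ∈ cubes ι Φ T := by
        rw [show F = a * m.1 from congrArg Subtype.val hFm]
        exact (isSubloop_cubes _ _).mul_mem ha (cubes_mono h1 hm)
      convert hFT using 2 with ω
      exact hρT _ (apply_mem_of_mem_cubes hT hFT ω)
    | mul_left z hz y _ ih =>
      intro F hF a ha h
      obtain ⟨J, hJ, hzJ⟩ := hz
      have hF' := (isSubloop_cubes Φ (Φ 1)).ldiv_mem (sub (hξ J hJ)) hF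
      have := ih _ hF' a ha (by
        rw [map_mul, z.isCentral.left, hzJ] at h
        refine left_cancel (a := hN.proj (cubeElem (sub (hξ J hJ)))) ?_
        rw [← h, ← map_mul]
        exact congrArg hN.proj (mul_ldiv (cubeElem (sub (hξ J hJ))) (cubeElem hF)))
      convert this using 2 with ω
      by_cases hω : ∀ t ∈ J, ω t = true
      · rw [pi_ldiv_apply, face, if_pos hω, ← hρ (ldiv x (F ω)), mul_ldiv]
      · rw [pi_ldiv_apply, face, if_neg hω, ldiv_one_left]
    | inv_mul_cancel z hz y _ ih =>
      intro F hF a ha h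
      obtain ⟨J, hJ, hzJ⟩ := hz
      have hF' := (isSubloop_cubes Φ (Φ 1)).mul_mem (sub (hξ J hJ)) hF
      have := ih _ hF' a ha (by
        have e : hN.proj (cubeElem hF') = z.val * hN.proj (cubeElem hF) := by
          rw [hzJ, ← map_mul]
          rfl
        rw [e, h, ← z.isCentral.left, ← map_mul, mul_inv_cancel_left])
      convert this using 2 with ω
      by_cases hω : ∀ t ∈ J, ω t = true
      · rw [Pi.mul_apply, face, if_pos hω, hρ]
      · rw [Pi.mul_apply, face, if_neg hω, one_mul]
  -- Faces of codimension greater than `i` have values in `Φ (i + 1)` and contribute to `A`. For the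
  -- others, `face J` is a homomorphism, and `hgen` reduces the value to `x` and elements of `T`.
  have gen : ∀ G, (hG : G ∈ cubes ι Φ T') →
      ∃ z ∈ Subgroup.closure gens ⊔ A, z.val = hN.proj (cubeElem (sub hG)) := by
    intro G hG
    refine subloopClosure_induction (P := fun G => ∀ hG : G ∈ cubes ι Φ T',
      ∃ z ∈ Subgroup.closure gens ⊔ A, z.val = hN.proj (cubeElem (sub hG))) ?_ ?_ ?_ ?_ ?_ hG hG
    · rintro _ ⟨J, g, hg, hgJ, rfl⟩ hG
      rcases Nat.lt_or_ge i J.card with hJ | hJ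
      · obtain ⟨z, hz⟩ := exists_center (cen _ hG)
        exact ⟨z, Subgroup.mem_sup_right
          ⟨_, face_mem_cubes (h1 (hΦ.anti hJ hgJ)) hgJ, hz⟩, hz⟩
      · have hface : ∀ g ∈ Φ i, face J g ∈ cubes ι Φ (Φ 1) := fun g hg =>
          face_mem_cubes (hΦ.anti hi hg) (hΦ.anti hJ hg)
        obtain ⟨w, hw⟩ := exists_center (cen _ (hξ J hJ))
        have hwm : w ∈ Subgroup.closure gens ⊔ A :=
          Subgroup.mem_sup_left (Subgroup.subset_closure ⟨J, hJ, hw⟩)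
        have := hgen {g | ∃ (hg : g ∈ Φ i), ∃ z ∈ Subgroup.closure gens ⊔ A,
          z.val = hN.proj (cubeElem (hface g hg))} ?_ ?_ ?_ hg
        · obtain ⟨_, h⟩ := this
          exact h
        · intro t ht
          have hm := face_mem_cubes (Φ := Φ) ht (hΦ.anti hJ (h2 (hTT' ht)))
          obtain ⟨z, hz⟩ := exists_center (cen _ (cubes_mono hTT' hm))
          exact ⟨h2 (hTT' ht), z, Subgroup.mem_sup_right ⟨_, hm, hz⟩, hz⟩
        · rintro g ⟨hg, z, hz, hzg⟩
          refine ⟨(hΦ.normal i).mul_mem (h2 hx) hg, w * z, mul_mem hwm hz, ?_⟩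
          rw [map_mul, hzg, hw, ← map_mul]
          exact congrArg hN.proj (Subtype.ext (face_mul J x g).symm)
        · rintro g ⟨hg, z, hz, hzg⟩
          refine ⟨(hΦ.normal i).ldiv_mem (h2 hx) hg, w⁻¹ * z, mul_mem (inv_mem hwm) hz, ?_⟩
          rw [Center.val_inv_mul, hzg, hw, ← map_ldiv]
          exact congrArg hN.proj (Subtype.ext (face_ldiv J x g).symm)
    · exact fun h1 => ⟨1, one_mem _, (map_one _).trans (map_one hN.proj).symm⟩
    · intro F G hF hG hF' hG' h
      obtain ⟨z, hz, hz'⟩ := hF' hF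
      obtain ⟨w, hw, hw'⟩ := hG' hG
      refine ⟨z * w, mul_mem hz hw, ?_⟩
      rw [map_mul, hz', hw', ← map_mul]
      rfl
    · intro F G hF hG hF' hG' h
      obtain ⟨z, hz, hz'⟩ := hF' hF
      obtain ⟨w, hw, hw'⟩ := hG' hG
      refine ⟨z⁻¹ * w, mul_mem (inv_mem hz) hw, ?_⟩
      rw [Center.val_inv_mul, hz', hw', ← map_ldiv]
      rfl
    · intro F G hF hG hF' hG' h
      obtain ⟨z, hz, hz'⟩ := hF' hF
      obtain ⟨w, hw, hw'⟩ := hG' hG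
      refine ⟨z * w⁻¹, mul_mem hz (inv_mem hw), ?_⟩
      rw [Center.val_mul_inv, hz', hw', ← map_rdiv]
      rfl
  obtain ⟨z, hz, hzF⟩ := gen F hF
  obtain ⟨y, hy, w, ⟨a, ha, hwa⟩, rfl⟩ := Subgroup.mem_sup.1 hz
  exact claim y hy F (sub hF) a ha (by rw [← hzF, map_mul, hwa])

end IsFiltration

/-- The sign of a vertex of a cube. -/
def cubeSign [Fintype ι] (ω : ι → Bool) : ℤ := ∏ t, if ω t = true then 1 else -1

/-- Flipping a coordinate outside `J` reverses the sign and preserves the face. -/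
theorem sum_cubeSign_face [Fintype ι] [DecidableEq ι] {J : Finset ι}
    (hJ : J.card < Fintype.card ι) (a : ℤ) :
    ∑ ω : ι → Bool, cubeSign ω * (if ∀ t ∈ J, ω t = true then a else 0) = 0 := by
  obtain ⟨s, hs⟩ : ∃ s, s ∉ J := by
    by_contra h
    push Not at h
    have : J = Finset.univ := Finset.eq_univ_of_forall h
    rw [this, Finset.card_univ] at hJ
    exact lt_irrefl _ hJ
  refine Finset.sum_involution (fun ω _ => Function.update ω s (!ω s)) ?_ ?_ (by simp) ?_
  · intro ω _
    have h1 : cubeSign (Function.update ω s (!ω s)) = -cubeSign ω := by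
      rw [cubeSign, cubeSign, ← Finset.mul_prod_erase Finset.univ _ (Finset.mem_univ s),
        ← Finset.mul_prod_erase Finset.univ (fun t => if ω t = true then (1 : ℤ) else -1)
          (Finset.mem_univ s), ← neg_mul]
      congr 1
      · rw [Function.update_self]
        cases ω s <;> simp
      · refine Finset.prod_congr rfl fun t ht => ?_
        rw [Function.update_of_ne (Finset.ne_of_mem_erase ht)]
    have h2 : (∀ t ∈ J, Function.update ω s (!ω s) t = true) ↔ ∀ t ∈ J, ω t = true := by
      refine forall₂_congr fun t ht => ?_
      rw [Function.update_of_ne (by rintro rfl; exact hs ht)]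
    simp only [h1, h2]
    ring
  · intro ω _ _ h
    have := congrFun h s
    rw [Function.update_self] at this
    cases hω : ω s <;> simp [hω] at this
  · intro ω _
    simp

/-- An additive function of weight `i` has vanishing alternating sums over cubes of dimension
greater than `i`. -/
theorem IsFiltration.sum_cubeSign_additive [Fintype ι] [DecidableEq ι] {Φ : ℕ → Set L} {i : ℕ}
    (hΦ : IsFiltration Φ) {T' : Set L} (hT' : IsSubloop T')
    (hι : i < Fintype.card ι) {f : L → ℤ}
    (hf : ∀ g ∈ T', ∀ h ∈ T', f (g * h) = f g + f h) (hf0 : ∀ g ∈ Φ (i + 1), f g = 0)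
    {F : (ι → Bool) → L} (hF : F ∈ cubes ι Φ T') : ∑ ω, cubeSign ω * f (F ω) = 0 := by
  have mem := fun {F : (ι → Bool) → L} (hF : F ∈ cubes ι Φ T') ω =>
    apply_mem_of_mem_cubes hT' hF ω
  have hf1 : f 1 = 0 := by
    have := hf 1 hT'.one_mem 1 hT'.one_mem
    rw [mul_one] at this
    omega
  refine subloopClosure_induction (P := fun F => ∑ ω, cubeSign ω * f (F ω) = 0) ?_ ?_ ?_ ?_ ?_ hF
  · rintro _ ⟨J, g, hg, hgJ, rfl⟩
    rcases Nat.lt_or_ge i J.card with hJ | hJ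
    · refine Finset.sum_eq_zero fun ω _ => ?_
      rw [face]
      split_ifs
      · rw [hf0 g (hΦ.anti hJ hgJ), mul_zero]
      · rw [hf1, mul_zero]
    · rw [← sum_cubeSign_face (hJ.trans_lt hι) (f g)]
      refine Finset.sum_congr rfl fun ω _ => ?_
      rw [face]
      split_ifs
      · rfl
      · rw [hf1]
  · simp [hf1]
  · intro F G hF hG hF' hG'
    rw [← add_zero (0 : ℤ)]
    nth_rw 1 [← hF']
    rw [← hG', ← Finset.sum_add_distrib]
    refine Finset.sum_congr rfl fun ω _ => ?_
    rw [Pi.mul_apply, hf _ (mem hF ω) _ (mem hG ω), mul_add]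
  · intro F G hF hG hF' hG'
    rw [← sub_zero (0 : ℤ)]
    nth_rw 1 [← hG']
    rw [← hF', ← Finset.sum_sub_distrib]
    refine Finset.sum_congr rfl fun ω _ => ?_
    have := hf _ (mem hF ω) _ (hT'.ldiv_mem (mem hF ω) (mem hG ω))
    rw [mul_ldiv] at this
    rw [pi_ldiv_apply, this]
    ring
  · intro F G hF hG hF' hG'
    rw [← sub_zero (0 : ℤ)]
    nth_rw 1 [← hF']
    rw [← hG', ← Finset.sum_sub_distrib]
    refine Finset.sum_congr rfl fun ω _ => ?_
    have := hf _ (hT'.rdiv_mem (mem hF ω) (mem hG ω)) _ (mem hG ω)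
    rw [rdiv_mul] at this
    rw [pi_rdiv_apply, this]
    ring

end CyclicSteps

/-! ### Alternating sums over cubes in the loop algebra. -/

section LinearExtension

variable {k L V : Type*} [Field k] [AddCommGroup V] [Module k V]

/-- The linear extension of a function on `L` to `k[L]`. -/
noncomputable def linearExtend (f : L → V) : MonoidAlgebra k L →ₗ[k] V where
  toFun x := Finsupp.linearCombination k f x.coeff
  map_add' x y := by rw [MonoidAlgebra.coeff_add, map_add]
  map_smul' c x := by rw [MonoidAlgebra.coeff_smul, map_smul, RingHom.id_apply]

@[simp] theorem linearExtend_single (f : L → V) (g : L) (c : k) :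
    linearExtend f (MonoidAlgebra.single g c) = c • f g := by
  simp [linearExtend]

variable (k) in
/-- The alternating sum over the vertices of a cube. -/
noncomputable def boundary {ι : Type} [Fintype ι] [DecidableEq ι] (F : (ι → Bool) → L) :
    MonoidAlgebra k L := ∑ ω, MonoidAlgebra.single (F ω) ((cubeSign ω : ℤ) : k)

theorem linearExtend_boundary {V : Type*} [AddCommGroup V] [Module k V] (f : L → V) {ι : Type}
    [Fintype ι] [DecidableEq ι] (F : (ι → Bool) → L) :
    linearExtend f (boundary k F) = ∑ ω, ((cubeSign ω : ℤ) : k) • f (F ω) := by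
  simp [boundary]

end LinearExtension

section CubeSpan

variable {k L : Type*} [Field k] [AlgebraicLoop L]

variable (k) in
/-- The span of the alternating sums over cubes of dimension at least `d` with values in `S`. -/
noncomputable def cubeSpan (Φ : ℕ → Set L) (S : Set L) (d : ℕ) : Submodule k (MonoidAlgebra k L) :=
  Submodule.span k {y | ∃ (ι : Type) (_ : Fintype ι) (_ : DecidableEq ι), d ≤ Fintype.card ι ∧
    ∃ F ∈ cubes ι Φ S, y = boundary k F}

theorem boundary_mem_cubeSpan {Φ : ℕ → Set L} {S : Set L} {d : ℕ} {ι : Type} [Fintype ι]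
    [DecidableEq ι] (hd : d ≤ Fintype.card ι) {F : (ι → Bool) → L} (hF : F ∈ cubes ι Φ S) :
    boundary k F ∈ cubeSpan k Φ S d :=
  Submodule.subset_span ⟨ι, _, _, hd, F, hF, rfl⟩

theorem cubeSpan_mono (Φ : ℕ → Set L) {S T : Set L} (h : S ⊆ T) (d : ℕ) :
    cubeSpan k Φ S d ≤ cubeSpan k Φ T d := by
  refine Submodule.span_le.2 ?_
  rintro _ ⟨ι, _, _, hd, F, hF, rfl⟩
  exact boundary_mem_cubeSpan hd (cubes_mono h hF)

theorem cubeSpan_anti (Φ : ℕ → Set L) (S : Set L) : Antitone (cubeSpan k Φ S) := by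
  intro d e hde
  refine Submodule.span_le.2 ?_
  rintro _ ⟨ι, _, _, hd, F, hF, rfl⟩
  exact boundary_mem_cubeSpan (hde.trans hd) hF

/-- Dummy coordinates do not change the codimension of a face. -/
theorem comp_embedding_mem_cubes {Φ : ℕ → Set L} {S : Set L} {ι κ : Type} (e : ι ↪ κ)
    {F : (ι → Bool) → L} (hF : F ∈ cubes ι Φ S) :
    (fun ω : κ → Bool => F (fun t => ω (e t))) ∈ cubes κ Φ S := by
  have hs := isSubloop_cubes (ι := κ) Φ S
  refine subloopClosure_induction
    (P := fun F => (fun ω : κ → Bool => F (fun t => ω (e t))) ∈ cubes κ Φ S) ?_ hs.one_mem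
    (fun _ _ _ _ hx hy => hs.mul_mem hx hy) (fun _ _ _ _ hx hy => hs.ldiv_mem hx hy)
    (fun _ _ _ _ hx hy => hs.rdiv_mem hx hy) hF
  rintro _ ⟨J, g, hg, hgJ, rfl⟩
  have := face_mem_cubes (Φ := Φ) (J := J.map e) hg (by rwa [Finset.card_map])
  convert this using 1
  funext ω
  simp only [face, Finset.forall_mem_map]

theorem boundary_mul {ι κ : Type} [Fintype ι] [DecidableEq ι] [Fintype κ] [DecidableEq κ]
    (F : (ι → Bool) → L) (G : (κ → Bool) → L) :
    boundary k F * boundary k G = boundary k (fun ω : ι ⊕ κ → Bool =>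
      F (fun t => ω (Sum.inl t)) * G (fun t => ω (Sum.inr t))) := by
  rw [boundary, boundary, boundary, Finset.sum_mul_sum, ← Finset.sum_product',
    Finset.univ_product_univ]
  refine (Fintype.sum_equiv (Equiv.sumArrowEquivProdArrow ι κ Bool) _ _ fun ω => ?_).symm
  rw [MonoidAlgebra.single_mul_single, ← Int.cast_mul]
  congr 2
  rw [cubeSign, Fintype.prod_sum_type]
  rfl

theorem mul_mem_cubeSpan {Φ : ℕ → Set L} {S : Set L} {p q : ℕ} {a b : MonoidAlgebra k L}
    (ha : a ∈ cubeSpan k Φ S p) (hb : b ∈ cubeSpan k Φ S q) : a * b ∈ cubeSpan k Φ S (p + q) := by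
  induction ha using Submodule.span_induction with
  | zero => rw [zero_mul]; exact zero_mem _
  | add x y _ _ hx hy => rw [add_mul]; exact add_mem hx hy
  | smul c x _ hx => rw [smul_mul_assoc]; exact Submodule.smul_mem _ _ hx
  | mem x hx =>
    obtain ⟨ι, _, _, hι, F, hF, rfl⟩ := hx
    induction hb using Submodule.span_induction with
    | zero => rw [mul_zero]; exact zero_mem _
    | add x y _ _ hx hy => rw [mul_add]; exact add_mem hx hy
    | smul c x _ hx => rw [mul_smul_comm]; exact Submodule.smul_mem _ _ hx
    | mem y hy =>
      obtain ⟨κ, _, _, hκ, G, hG, rfl⟩ := hy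
      rw [boundary_mul]
      refine boundary_mem_cubeSpan (by rw [Fintype.card_sum]; omega) ?_
      exact (isSubloop_cubes _ _).mul_mem (comp_embedding_mem_cubes Function.Embedding.inl hF)
        (comp_embedding_mem_cubes Function.Embedding.inr hG)

/-- This is the alternating sum over the one-dimensional cube with vertices `1` and `g`. -/
theorem single_sub_one_mem_cubeSpan {Φ : ℕ → Set L} {S : Set L} {g : L} (hS : g ∈ S)
    (hg : g ∈ Φ 1) :
    MonoidAlgebra.single g (1 : k) - 1 ∈ cubeSpan k Φ S 1 := by
  have := boundary_mem_cubeSpan (k := k) (ι := Unit) (d := 1) (by simp)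
    (face_mem_cubes (Φ := Φ) (J := Finset.univ) hS (by simpa using hg))
  convert this using 1
  rw [boundary, ← (Equiv.funUnique Unit Bool).symm.sum_comp]
  simp [face, cubeSign, MonoidAlgebra.one_def, sub_eq_add_neg]

end CubeSpan

/-! ### Powers of the augmentation ideal. -/

section AugmentationPowers

variable {k L : Type*} [Field k] [AlgebraicLoop L]

@[simp] theorem augmentation_single (g : L) (c : k) :
    augmentation k L (MonoidAlgebra.single g c) = c := by
  simp [augmentation]

theorem augmentation_one : augmentation k L 1 = 1 := augmentation_single 1 1

theorem mem_augmentationIdeal {a : MonoidAlgebra k L} :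
    a ∈ augmentationIdeal k L ↔ augmentation k L a = 0 := TwoSidedIdeal.mem_ker _

/-- The difference of an element and its augmentation is a combination of the elements `g - 1`. -/
theorem sub_augmentation_mem (a : MonoidAlgebra k L) : a - augmentation k L a • 1 ∈
    Submodule.span k (Set.range fun g : L => MonoidAlgebra.single g (1 : k) - 1) := by
  induction a using MonoidAlgebra.induction_linear with
  | zero => rw [map_zero, zero_smul, sub_zero]; exact zero_mem _
  | add x y hx hy =>
    have := add_mem hx hy
    rw [map_add, add_smul]
    convert this using 1
    abel
  | single g c =>
    rw [augmentation_single]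
    have := Submodule.smul_mem _ c (Submodule.subset_span (R := k)
      (s := Set.range fun g : L => MonoidAlgebra.single g (1 : k) - 1) ⟨g, rfl⟩)
    simpa only [smul_sub, MonoidAlgebra.smul_single, smul_eq_mul, mul_one] using this

variable (k L) in
/-- The powers of the augmentation ideal, as subspaces. -/
noncomputable def augPow (m : ℕ) : Submodule k (MonoidAlgebra k L) :=
  Submodule.span k {a | ∃ m' : ℕ, m ≤ m' ∧ IsIdealProduct (augmentationIdeal k L) m' a}

theorem augPow_anti : Antitone (augPow k L) := fun _ _ h =>
  Submodule.span_mono fun _ ⟨m', hm, ha⟩ => ⟨m', h.trans hm, ha⟩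

theorem mul_mem_augPow {p q : ℕ} {a b : MonoidAlgebra k L}
    (ha : a ∈ augPow k L p) (hb : b ∈ augPow k L q) : a * b ∈ augPow k L (p + q) := by
  induction ha using Submodule.span_induction with
  | zero => rw [zero_mul]; exact zero_mem _
  | add x y _ _ hx hy => rw [add_mul]; exact add_mem hx hy
  | smul c x _ hx => rw [smul_mul_assoc]; exact Submodule.smul_mem _ _ hx
  | mem x hx =>
    obtain ⟨p', hp, hx⟩ := hx
    induction hb using Submodule.span_induction with
    | zero => rw [mul_zero]; exact zero_mem _
    | add x y _ _ hx hy => rw [mul_add]; exact add_mem hx hy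
    | smul c x _ hx => rw [mul_smul_comm]; exact Submodule.smul_mem _ _ hx
    | mem y hy =>
      obtain ⟨q', hq, hy⟩ := hy
      exact Submodule.subset_span ⟨p' + q', by omega, hx.mul hy⟩

theorem IsIdealProduct.mem {R : Type*} [NonUnitalNonAssocRing R] {J : TwoSidedIdeal R} {m : ℕ}
    {a : R} (h : IsIdealProduct J m a) : a ∈ J := by
  induction h with
  | of h => exact h
  | mul _ _ ha _ => exact J.mul_mem_right _ _ ha

theorem mem_augPow_one {a : MonoidAlgebra k L} : a ∈ augPow k L 1 ↔ augmentation k L a = 0 := by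
  constructor
  · intro h
    induction h using Submodule.span_induction with
    | zero => rw [map_zero]
    | add x y _ _ hx hy => rw [map_add, hx, hy, add_zero]
    | smul c x _ hx => rw [map_smul, hx, smul_zero]
    | mem x hx =>
      obtain ⟨m, -, hx⟩ := hx
      exact mem_augmentationIdeal.1 hx.mem
  · exact fun h => Submodule.subset_span ⟨1, le_rfl, .of (mem_augmentationIdeal.2 h)⟩

theorem sub_augmentation_mem_augPow (a : MonoidAlgebra k L) :
    a - augmentation k L a • 1 ∈ augPow k L 1 := by
  rw [mem_augPow_one, map_sub, map_smul, augmentation_one, smul_eq_mul, mul_one, sub_self]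

theorem mul_left_mem_augPow {m : ℕ} (x : MonoidAlgebra k L) {a : MonoidAlgebra k L}
    (ha : a ∈ augPow k L m) : x * a ∈ augPow k L m := by
  have h1 := mul_mem_augPow (sub_augmentation_mem_augPow x) ha
  have h2 := Submodule.smul_mem _ (augmentation k L x) ha
  have := add_mem (augPow_anti (Nat.le_add_left m 1) h1) h2
  rwa [sub_mul, smul_mul_assoc, one_mul, sub_add_cancel] at this

theorem mul_right_mem_augPow {m : ℕ} (x : MonoidAlgebra k L) {a : MonoidAlgebra k L}
    (ha : a ∈ augPow k L m) : a * x ∈ augPow k L m := by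
  have h1 := mul_mem_augPow ha (sub_augmentation_mem_augPow x)
  have h2 := Submodule.smul_mem _ (augmentation k L x) ha
  have := add_mem (augPow_anti (Nat.le_add_right m 1) h1) h2
  rwa [mul_sub, mul_smul_comm, mul_one, sub_add_cancel] at this

/-- Every `x` is a scalar plus an element of `Δ`, so the linear span of the products is already
stable under multiplication by `k[L]`. -/
theorem mem_idealPow {m : ℕ} {a : MonoidAlgebra k L} :
    a ∈ idealPow (augmentationIdeal k L) m ↔ a ∈ augPow k L m := by
  constructor
  · intro h
    have hle : idealPow (augmentationIdeal k L) m ≤ TwoSidedIdeal.mk'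
        (augPow k L m : Set (MonoidAlgebra k L)) (zero_mem _) (fun h h' => add_mem h h')
        (fun h => neg_mem h) (fun {x _} h => mul_left_mem_augPow x h)
        (fun {_ y} h => mul_right_mem_augPow y h) := by
      refine TwoSidedIdeal.span_le.2 fun x hx => ?_
      rw [TwoSidedIdeal.coe_mk']
      exact Submodule.subset_span hx
    have := hle h
    rwa [TwoSidedIdeal.mem_mk'] at this
  · intro h
    induction h using Submodule.span_induction with
    | zero => exact zero_mem _
    | add x y _ _ hx hy => exact add_mem hx hy
    | smul c x _ hx =>
      have := TwoSidedIdeal.mul_mem_left _ (c • (1 : MonoidAlgebra k L)) x hx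
      rwa [smul_mul_assoc, one_mul] at this
    | mem x hx => exact TwoSidedIdeal.subset_span hx

theorem augPow_le_cubeSpan {Φ : ℕ → Set L} (hΦ : IsFiltration Φ) (m : ℕ) :
    augPow k L m ≤ cubeSpan k Φ (Φ 1) m := by
  refine Submodule.span_le.2 ?_
  rintro a ⟨m', hm, ha⟩
  refine cubeSpan_anti _ _ hm ?_
  clear hm
  induction ha with
  | @of a ha =>
    have h := sub_augmentation_mem a
    rw [mem_augmentationIdeal.1 ha, zero_smul, sub_zero] at h
    refine Submodule.span_le.2 ?_ h
    rintro _ ⟨g, rfl⟩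
    exact single_sub_one_mem_cubeSpan (hΦ.mem_one g) (hΦ.mem_one g)
  | mul _ _ ha hb => exact mul_mem_cubeSpan ha hb

end AugmentationPowers

/-! ### Descent through the layers of an isolated filtration. -/

section Layers

variable {L : Type*} [AlgebraicLoop L]

/-- Left multiplication as a permutation. -/
def mulLeftPerm (x : L) : Equiv.Perm L where
  toFun y := x * y
  invFun y := ldiv x y
  left_inv y := ldiv_mul x y
  right_inv y := mul_ldiv x y

theorem mulLeftPerm_zpow_mem {X : Set L} {x : L} (h1 : ∀ g ∈ X, x * g ∈ X)
    (h2 : ∀ g ∈ X, ldiv x g ∈ X) (a : ℤ) {g : L} (hg : g ∈ X) : (mulLeftPerm x ^ a) g ∈ X := by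
  induction a with
  | zero => exact hg
  | succ a ih =>
    rw [add_comm, zpow_one_add]
    exact h1 _ ih
  | pred a ih =>
    rw [sub_eq_add_neg, add_comm, zpow_add, zpow_neg_one]
    exact h2 _ ih

/-- Iterates of left multiplication by `x` form an action of `ℤ`, which products with powers of `x`
need not do in a loop; modulo `N` they are multiplication by powers of a central element. -/
theorem IsNormalSubloop.proj_mulLeftPerm_zpow {N : Set L} (hN : IsNormalSubloop N) {x : L}
    {z : Center hN.Quotient} (hz : hN.proj x = z.val) (a : ℤ) (g : L) :
    hN.proj ((mulLeftPerm x ^ a) g) = (z ^ a).val * hN.proj g := by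
  induction a with
  | zero => simp
  | succ a ih =>
    rw [add_comm, zpow_one_add, zpow_one_add, map_mul, z.isCentral.left, ← ih, ← hz, ← map_mul]
    rfl
  | pred a ih =>
    refine left_cancel (a := z.val) ?_
    rw [← z.isCentral.left, ← map_mul, ← zpow_one_add, ← hz, ← map_mul, add_sub_cancel, ← ih]
    congr 1
    refine Eq.trans (b := (mulLeftPerm x * mulLeftPerm x ^ (-(a : ℤ) - 1)) g) rfl ?_
    rw [← zpow_one_add, add_sub_cancel]

/-- The elements of `S` whose images modulo `N` lie in the subgroup `B` of the centre of the
quotient. -/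
def layer {N : Set L} (hN : IsNormalSubloop N) (S : Set L) (B : Subgroup (Center hN.Quotient)) :
    Set L := {g | g ∈ S ∧ ∃ z ∈ B, hN.proj g = z.val}

variable {N S : Set L} {hN : IsNormalSubloop N}

theorem layer_mono {B B' : Subgroup (Center hN.Quotient)} (h : B ≤ B') :
    layer hN S B ⊆ layer hN S B' := fun _ ⟨hg, z, hz, hzg⟩ => ⟨hg, z, h hz, hzg⟩

theorem layer_bot (h : N ⊆ S) : layer hN S ⊥ = N := by
  ext g
  constructor
  · rintro ⟨-, z, hz, hzg⟩
    rw [Subgroup.mem_bot.1 hz, map_one] at hzg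
    exact hN.proj_eq_one.1 hzg
  · exact fun hg => ⟨h hg, 1, one_mem _, (hN.proj_eq_one.2 hg).trans (map_one _).symm⟩

theorem subset_layer (h : N ⊆ S) (B : Subgroup (Center hN.Quotient)) : N ⊆ layer hN S B :=
  (layer_bot h).symm.subset.trans (layer_mono bot_le)

theorem isSubloop_layer (hS : IsSubloop S) (B : Subgroup (Center hN.Quotient)) :
    IsSubloop (layer hN S B) where
  one_mem := ⟨hS.one_mem, 1, one_mem _, (map_one _).trans (map_one _).symm⟩
  mul_mem := by
    rintro a b ⟨ha, z, hz, hza⟩ ⟨hb, w, hw, hwb⟩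
    exact ⟨hS.mul_mem ha hb, z * w, mul_mem hz hw, by rw [map_mul, map_mul, hza, hwb]⟩
  ldiv_mem := by
    rintro a b ⟨ha, z, hz, hza⟩ ⟨hb, w, hw, hwb⟩
    exact ⟨hS.ldiv_mem ha hb, z⁻¹ * w, mul_mem (inv_mem hz) hw, by
      rw [Center.val_inv_mul, map_ldiv, hza, hwb]⟩
  rdiv_mem := by
    rintro a b ⟨ha, z, hz, hza⟩ ⟨hb, w, hw, hwb⟩
    exact ⟨hS.rdiv_mem ha hb, z * w⁻¹, mul_mem hz (inv_mem hw), by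
      rw [Center.val_mul_inv, map_rdiv, hza, hwb]⟩

/-- The centre elements of the quotient by `N` that are represented by elements of `S`. -/
def imageCenter (hN : IsNormalSubloop N) (hS : IsSubloop S) : Subgroup (Center hN.Quotient) where
  carrier := {z | ∃ g ∈ S, hN.proj g = z.val}
  one_mem' := ⟨1, hS.one_mem, (map_one _).trans (map_one _).symm⟩
  mul_mem' := by
    rintro z w ⟨a, ha, hza⟩ ⟨b, hb, hwb⟩
    exact ⟨a * b, hS.mul_mem ha hb, by rw [map_mul, map_mul, hza, hwb]⟩
  inv_mem' := by
    rintro z ⟨a, ha, hza⟩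
    exact ⟨ldiv a 1, hS.ldiv_mem ha hS.one_mem, by rw [map_ldiv, map_one, hza]; rfl⟩

theorem exists_exponent {B : Subgroup (Center hN.Quotient)} {z : Center hN.Quotient}
    (hz : ∀ a : ℤ, z ^ a ∈ B → a = 0) : ∃ f : L → ℤ,
    (∀ g (a : ℤ), ∀ b ∈ B, hN.proj g = (z ^ a * b).val → f g = a) := by
  classical
  refine ⟨fun g => if h : ∃ a : ℤ, ∃ b ∈ B, hN.proj g = (z ^ a * b).val then h.choose else 0, ?_⟩
  intro g a b hb hg
  have h : ∃ a : ℤ, ∃ b ∈ B, hN.proj g = (z ^ a * b).val := ⟨a, b, hb, hg⟩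
  simp only [dif_pos h]
  obtain ⟨b', hb', hg'⟩ := h.choose_spec
  have e := Center.val_injective (hg'.symm.trans hg)
  refine sub_eq_zero.1 (hz _ ?_)
  have : z ^ (h.choose - a) = b * b'⁻¹ := by
    rw [zpow_sub, eq_mul_inv_iff_mul_eq, mul_right_comm, e, mul_right_comm, mul_inv_cancel,
      one_mul]
  rw [this]
  exact mul_mem hb (inv_mem hb')

variable {k : Type*} [Field k] [CharZero k] {Φ : ℕ → Set L} {n i d : ℕ}

/-- Descent along an infinite cyclic extension inside a layer of a filtration. -/
theorem IsFiltration.single_sub_one_mem_of_sup_zpowers (hΦ : IsFiltration Φ)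
    (hn : Φ (n + 1) = {1}) (hi : 1 ≤ i) (hd : i < d)
    {B : Subgroup (Center (hΦ.normal (i + 1)).Quotient)}
    {z : Center (hΦ.normal (i + 1)).Quotient}
    (hz : z ∈ imageCenter (hΦ.normal (i + 1)) (hΦ.normal i).toIsSubloop)
    (hzB : ∀ a : ℤ, z ^ a ∈ B → a = 0) {g : L}
    (hg : g ∈ layer (hΦ.normal (i + 1)) (Φ i) (B ⊔ Subgroup.zpowers z))
    (hgd : MonoidAlgebra.single g (1 : k) - 1 ∈
      cubeSpan k Φ (layer (hΦ.normal (i + 1)) (Φ i) (B ⊔ Subgroup.zpowers z)) d) :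
    g ∈ layer (hΦ.normal (i + 1)) (Φ i) B ∧ MonoidAlgebra.single g (1 : k) - 1 ∈
      cubeSpan k Φ (layer (hΦ.normal (i + 1)) (Φ i) B) d := by
  classical
  have hN := hΦ.normal (i + 1)
  have hS := (hΦ.normal i).toIsSubloop
  obtain ⟨x, hxi, hx⟩ := hz
  obtain ⟨f, hf⟩ := exists_exponent hzB
  set T := layer hN (Φ i) B with hT
  set T' := layer hN (Φ i) (B ⊔ Subgroup.zpowers z) with hT'
  have loopT : IsSubloop T := isSubloop_layer hS B
  have loopT' : IsSubloop T' := isSubloop_layer hS _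
  have hsub : Φ (i + 1) ⊆ Φ i := hΦ.anti (Nat.le_succ i)
  have hTT' : T ⊆ T' := layer_mono le_sup_left
  have mem' : ∀ {g}, g ∈ T' ↔ g ∈ Φ i ∧ ∃ a : ℤ, ∃ b ∈ B, hN.proj g = (z ^ a * b).val := by
    intro g
    refine and_congr Iff.rfl ⟨?_, ?_⟩
    · rintro ⟨y, hy, hgy⟩
      obtain ⟨b, hb, _, ⟨a, rfl⟩, rfl⟩ := Subgroup.mem_sup.1 hy
      exact ⟨a, b, hb, by rw [hgy, mul_comm]⟩
    · rintro ⟨a, b, hb, hgy⟩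
      exact ⟨_, mul_mem (Subgroup.mem_sup_right (zpow_mem (Subgroup.mem_zpowers z) a))
        (Subgroup.mem_sup_left hb), hgy⟩
  have hxT' : x ∈ T' := mem'.2 ⟨hxi, 1, 1, one_mem _, by rw [zpow_one, mul_one, hx]⟩
  have fT : ∀ g ∈ T, f g = 0 := by
    rintro g ⟨-, b, hb, hgb⟩
    exact hf g 0 b hb (by rw [zpow_zero, one_mul, hgb])
  have fmul : ∀ g ∈ T', ∀ h ∈ T', f (g * h) = f g + f h := by
    intro g hg h hh
    obtain ⟨-, a, b, hb, hgb⟩ := mem'.1 hg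
    obtain ⟨-, a', b', hb', hhb⟩ := mem'.1 hh
    rw [hf g a b hb hgb, hf h a' b' hb' hhb]
    refine hf _ _ (b * b') (mul_mem hb hb') ?_
    rw [map_mul, hgb, hhb, ← map_mul, zpow_add, mul_mul_mul_comm]
  have shift : ∀ g ∈ T', (mulLeftPerm x ^ (-f g)) g ∈ T := by
    intro g hg
    obtain ⟨hgi, a, b, hb, hgb⟩ := mem'.1 hg
    refine ⟨mulLeftPerm_zpow_mem (fun g hg => hS.mul_mem hxi hg) (fun g hg => hS.ldiv_mem hxi hg)
      _ hgi, b, hb, ?_⟩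
    rw [hN.proj_mulLeftPerm_zpow hx, hgb, hf g a b hb hgb, ← map_mul, ← mul_assoc, ← zpow_add,
      neg_add_cancel, zpow_zero, one_mul]
  -- The exponent `f` annihilates all alternating sums in question, so `f g = f 1 = 0` in `k`, hence
  -- in `ℤ` by characteristic zero.
  have hgT : g ∈ T := by
    have key : ∀ y ∈ cubeSpan k Φ T' d, linearExtend (fun g => (f g : k)) y = 0 := by
      intro y hy
      induction hy using Submodule.span_induction with
      | zero => exact map_zero _
      | add x y _ _ hx hy => rw [map_add, hx, hy, add_zero]
      | smul c x _ hx => rw [map_smul, hx, smul_zero]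
      | mem y hy =>
        obtain ⟨ι, _, _, hι, F, hF, rfl⟩ := hy
        rw [linearExtend_boundary]
        have := congrArg (fun t : ℤ => (t : k)) (hΦ.sum_cubeSign_additive loopT' (hd.trans_le hι)
          fmul (fun g hg => fT g (subset_layer hsub B hg)) hF)
        simpa using this
    have h0 := key _ hgd
    rw [map_sub, MonoidAlgebra.one_def, linearExtend_single, linearExtend_single,
      fT 1 loopT.one_mem] at h0
    have hfg : f g = 0 := by simpa using h0
    have := shift g hg
    rwa [hfg, neg_zero, zpow_zero] at this
  refine ⟨hgT, ?_⟩
  -- The retraction removes the `x`-component. The value `1` outside `T'` is a default, chosen so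
  -- that invariance under `x` holds everywhere.
  let ρ : L → L := fun g => if g ∈ T' then (mulLeftPerm x ^ (-f g)) g else 1
  have hρT : ∀ t ∈ T, ρ t = t := by
    intro t ht
    simp only [ρ, if_pos (hTT' ht), fT t ht, neg_zero, zpow_zero, Equiv.Perm.one_apply]
  have hfx : f x = 1 := hf x 1 1 (one_mem _) (by rw [zpow_one, mul_one, hx])
  have hρ : ∀ g, ρ (x * g) = ρ g := by
    intro g
    by_cases hg : g ∈ T'
    · simp only [ρ, if_pos hg, if_pos (loopT'.mul_mem hxT' hg), fmul x hxT' g hg, hfx]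
      refine Eq.trans (b := (mulLeftPerm x ^ (-(1 + f g)) * mulLeftPerm x) g) rfl ?_
      rw [← zpow_add_one]
      congr 2
      ring
    · have : x * g ∉ T' := fun h => hg (by
        have := loopT'.ldiv_mem hxT' h
        rwa [ldiv_mul] at this)
      simp only [ρ, if_neg hg, if_neg this]
  have hgen : ∀ X : Set L, T ⊆ X → (∀ g ∈ X, x * g ∈ X) → (∀ g ∈ X, ldiv x g ∈ X) → T' ⊆ X := by
    intro X hX h1 h2 g hg
    have := mulLeftPerm_zpow_mem h1 h2 (f g) (hX (shift g hg))
    rwa [← Equiv.Perm.mul_apply, ← zpow_add, add_neg_cancel, zpow_zero] at this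
  have key : ∀ y ∈ cubeSpan k Φ T' d, linearExtend (fun g => MonoidAlgebra.single (ρ g) (1 : k)) y
      ∈ cubeSpan k Φ T d := by
    intro y hy
    induction hy using Submodule.span_induction with
    | zero => rw [map_zero]; exact zero_mem _
    | add x y _ _ hx hy => rw [map_add]; exact add_mem hx hy
    | smul c x _ hx => rw [map_smul]; exact Submodule.smul_mem _ _ hx
    | mem y hy =>
      obtain ⟨ι, _, _, hι, F, hF, rfl⟩ := hy
      have := boundary_mem_cubeSpan (k := k) hι (hΦ.comp_mem_cubes hn hi loopT
        (subset_layer hsub B) (fun g hg => hg.1) hTT' hxT' hgen hρ hρT hF)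
      rw [linearExtend_boundary]
      simpa [boundary] using this
  have := key _ hgd
  rwa [map_sub, MonoidAlgebra.one_def, linearExtend_single, linearExtend_single, one_smul,
    one_smul, hρT g hgT, hρT 1 loopT.one_mem] at this

theorem IsFiltration.single_sub_one_mem_of_linearIndependent (hΦ : IsFiltration Φ)
    (hn : Φ (n + 1) = {1}) (hi : 1 ≤ i) (hd : i < d) {r : ℕ}
    {v : Fin r → Center (hΦ.normal (i + 1)).Quotient}
    (hv : ∀ t, v t ∈ imageCenter (hΦ.normal (i + 1)) (hΦ.normal i).toIsSubloop)
    (hvi : LinearIndependent ℤ fun t => Additive.ofMul (v t)) {g : L}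
    (hg : g ∈ layer (hΦ.normal (i + 1)) (Φ i) (Subgroup.closure (Set.range v)))
    (hgd : MonoidAlgebra.single g (1 : k) - 1 ∈
      cubeSpan k Φ (layer (hΦ.normal (i + 1)) (Φ i) (Subgroup.closure (Set.range v))) d) :
    g ∈ Φ (i + 1) ∧ MonoidAlgebra.single g (1 : k) - 1 ∈ cubeSpan k Φ (Φ (i + 1)) d := by
  induction r with
  | zero =>
    rw [Set.range_eq_empty, Subgroup.closure_empty, layer_bot (hΦ.anti (Nat.le_succ i))] at hg hgd
    exact ⟨hg, hgd⟩
  | succ r ih =>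
    have e : Subgroup.closure (Set.range v) =
        Subgroup.closure (Set.range (Fin.init v)) ⊔ Subgroup.zpowers (v (Fin.last r)) := by
      conv_lhs => rw [← Fin.snoc_init_self v, Fin.range_snoc]
      rw [Set.insert_eq, Set.union_comm, Subgroup.closure_union, ← Subgroup.zpowers_eq_closure]
    rw [e] at hg hgd
    -- Linear independence says exactly that the last element generates an infinite cyclic
    -- complement to the others.
    have hlast : ∀ a : ℤ, v (Fin.last r) ^ a ∈ Subgroup.closure (Set.range (Fin.init v)) →
        a = 0 := by
      intro a ha
      refine hvi.eq_zero_of_smul_mem_span (Fin.last r) a ?_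
      change Additive.ofMul (v (Fin.last r) ^ a) ∈ _
      generalize v (Fin.last r) ^ a = w at ha ⊢
      induction ha using Subgroup.closure_induction with
      | one => exact zero_mem _
      | mul x y _ _ hx hy => exact add_mem hx hy
      | inv x _ hx => exact neg_mem hx
      | mem x hx =>
        obtain ⟨t, rfl⟩ := hx
        exact Submodule.subset_span ⟨t.castSucc, ⟨trivial, (Fin.castSucc_lt_last t).ne⟩, rfl⟩
    obtain ⟨h1, h2⟩ := hΦ.single_sub_one_mem_of_sup_zpowers hn hi hd (hv _) hlast hg hgd
    exact ih (fun t => hv t.castSucc) (hvi.comp _ (Fin.castSucc_injective r)) h1 h2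

theorem layer_closure_union_left {X Y : Set (Center hN.Quotient)} :
    layer hN S (Subgroup.closure X) ⊆ layer hN S (Subgroup.closure (X ∪ Y)) :=
  layer_mono (Subgroup.closure_mono Set.subset_union_left)

theorem layer_closure_union_right {X Y : Set (Center hN.Quotient)} :
    layer hN S (Subgroup.closure Y) ⊆ layer hN S (Subgroup.closure (X ∪ Y)) :=
  layer_mono (Subgroup.closure_mono Set.subset_union_right)

/-- Only finitely many faces enter the construction of a cube; this reduces the layers to finite
rank. -/
theorem exists_finite_mem_cubes {hS : IsSubloop S} (hc : ∀ g ∈ S, IsCentral (hN.proj g))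
    {ι : Type} {F : (ι → Bool) → L} (hF : F ∈ cubes ι Φ S) :
    ∃ X : Set (Center hN.Quotient), X.Finite ∧ X ⊆ imageCenter hN hS ∧
      F ∈ cubes ι Φ (layer hN S (Subgroup.closure X)) := by
  refine subloopClosure_induction (P := fun F => ∃ X : Set (Center hN.Quotient), X.Finite ∧
    X ⊆ imageCenter hN hS ∧ F ∈ cubes ι Φ (layer hN S (Subgroup.closure X)))
    ?_ ⟨∅, Set.finite_empty, Set.empty_subset _, (isSubloop_cubes _ _).one_mem⟩ ?_ ?_ ?_ hF
  · rintro _ ⟨J, g, hg, hgJ, rfl⟩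
    obtain ⟨z, hz⟩ := exists_center (hc g hg)
    refine ⟨{z}, Set.finite_singleton z, Set.singleton_subset_iff.2 ⟨g, hg, hz.symm⟩,
      face_mem_cubes ⟨hg, z, Subgroup.subset_closure rfl, hz.symm⟩ hgJ⟩
  all_goals
    rintro F G _ _ ⟨X, hX, hX', hFX⟩ ⟨Y, hY, hY', hGY⟩
    refine ⟨X ∪ Y, hX.union hY, Set.union_subset hX' hY', ?_⟩
    have h1 := cubes_mono (Φ := Φ) (layer_closure_union_left (Y := Y)) hFX
    have h2 := cubes_mono (Φ := Φ) (layer_closure_union_right (X := X)) hGY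
  · exact (isSubloop_cubes _ _).mul_mem h1 h2
  · exact (isSubloop_cubes _ _).ldiv_mem h1 h2
  · exact (isSubloop_cubes _ _).rdiv_mem h1 h2

theorem exists_finite_mem_cubeSpan {k : Type*} [Field k] {hS : IsSubloop S}
    (hc : ∀ g ∈ S, IsCentral (hN.proj g))
    {y : MonoidAlgebra k L} (hy : y ∈ cubeSpan k Φ S d) :
    ∃ X : Set (Center hN.Quotient), X.Finite ∧ X ⊆ imageCenter hN hS ∧
      y ∈ cubeSpan k Φ (layer hN S (Subgroup.closure X)) d := by
  induction hy using Submodule.span_induction with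
  | zero => exact ⟨∅, Set.finite_empty, Set.empty_subset _, zero_mem _⟩
  | add x y _ _ hx hy =>
    obtain ⟨X, hX, hX', hx⟩ := hx
    obtain ⟨Y, hY, hY', hy⟩ := hy
    exact ⟨X ∪ Y, hX.union hY, Set.union_subset hX' hY',
      add_mem (cubeSpan_mono Φ layer_closure_union_left d hx)
        (cubeSpan_mono Φ layer_closure_union_right d hy)⟩
  | smul c x _ hx =>
    obtain ⟨X, hX, hX', hx⟩ := hx
    exact ⟨X, hX, hX', Submodule.smul_mem _ _ hx⟩
  | mem y hy =>
    obtain ⟨ι, _, _, hι, F, hF, rfl⟩ := hy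
    obtain ⟨X, hX, hX', h⟩ := exists_finite_mem_cubes (hS := hS) hc hF
    exact ⟨X, hX, hX', boundary_mem_cubeSpan hι h⟩

/-- A finite subset of a torsion-free subgroup of an abelian group is contained in the subgroup
generated by finitely many independent elements. -/
theorem exists_linearIndependent_closure {Z : Type*} [CommGroup Z] {G : Subgroup Z}
    (hG : ∀ z ∈ G, ∀ a : ℤ, a ≠ 0 → z ^ a = 1 → z = 1) {X : Set Z} (hX : X.Finite) (hXG : X ⊆ G) :
    ∃ (r : ℕ) (v : Fin r → Z), (∀ t, v t ∈ G) ∧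
      LinearIndependent ℤ (fun t => Additive.ofMul (v t)) ∧ X ⊆ Subgroup.closure (Set.range v) := by
  let M : Submodule ℤ (Additive Z) := Submodule.span ℤ (Additive.toMul ⁻¹' X)
  have hMG : ∀ m ∈ M, m.toMul ∈ G := by
    intro m hm
    induction hm using Submodule.span_induction with
    | zero => exact one_mem _
    | add x y _ _ hx hy => exact mul_mem hx hy
    | smul c x _ hx => exact zpow_mem hx c
    | mem x hx => exact hXG hx
  have : Module.Finite ℤ M := Module.Finite.span_of_finite ℤ
    (hX.preimage Additive.toMul.injective.injOn)
  have : Module.IsTorsionFree ℤ M := .of_smul_eq_zero fun a m h => by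
    refine or_iff_not_imp_left.2 fun ha => Subtype.ext ?_
    exact hG _ (hMG _ m.2) a ha (congrArg Subtype.val h)
  -- A finitely generated torsion-free abelian group is free.
  let b := Module.finBasis ℤ M
  refine ⟨_, fun t => Additive.toMul (b t : Additive Z), fun t => hMG _ (b t).2,
    b.linearIndependent.map' M.subtype M.ker_subtype, fun x hx => ?_⟩
  let m : M := ⟨Additive.ofMul x, Submodule.subset_span hx⟩
  have hm := congrArg (fun m : M => Additive.toMul (m : Additive Z)) (b.sum_repr m)
  simp only [AddSubmonoidClass.coe_finsetSum, SetLike.val_smul, toMul_sum, toMul_zsmul] at hm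
  refine Eq.subst (motive := fun y => y ∈ Subgroup.closure _) hm
    (prod_mem fun t _ => zpow_mem ?_ _)
  exact Subgroup.subset_closure (Set.mem_range_self t)

theorem IsFiltration.single_sub_one_mem_succ (hΦ : IsFiltration Φ) (hn : Φ (n + 1) = {1})
    (hI : IsIsolated Φ n) (hi : 1 ≤ i) (hin : i ≤ n) (hd : i < d) {g : L} (hg : g ∈ Φ i)
    (hgd : MonoidAlgebra.single g (1 : k) - 1 ∈ cubeSpan k Φ (Φ i) d) :
    g ∈ Φ (i + 1) ∧ MonoidAlgebra.single g (1 : k) - 1 ∈ cubeSpan k Φ (Φ (i + 1)) d := by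
  have hN := hΦ.normal (i + 1)
  have hS := (hΦ.normal i).toIsSubloop
  have hc : ∀ g ∈ Φ i, IsCentral (hN.proj g) := fun g hg => hΦ.isCentral_proj hi hg
  obtain ⟨X, hX, hX', h⟩ := exists_finite_mem_cubeSpan (hN := hN) (hS := hS) hc hgd
  obtain ⟨z, hz⟩ := exists_center (hc g hg)
  have pow_eq : ∀ z ∈ imageCenter hN hS, ∀ N : ℕ, 0 < N → z ^ N = 1 → z = 1 := by
    rintro z ⟨x, hx, hxz⟩ N hN0 hzN
    have h1 : rpow x N ∈ Φ (i + 1) := hN.proj_eq_one.1 (by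
      rw [map_rpow, hxz, ← Center.val_pow, hzN, map_one])
    have h2 := hN.proj_eq_one.2 (hI i hi hin x hx N hN0 h1)
    exact Center.val_injective (hxz.symm.trans (h2.trans (map_one _).symm))
  -- The class `z` of `g` is added to `X` so that `g` itself lies in the layer. Isolation of `Φ`
  -- supplies the torsion-freeness.
  obtain ⟨r, v, hv, hvi, hvX⟩ := exists_linearIndependent_closure (G := imageCenter hN hS)
    (X := insert z X) (fun w hw a ha hwa => by
      refine pow_eq w hw a.natAbs (Int.natAbs_pos.2 ha) ?_
      rcases Int.natAbs_eq a with h | h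
      · rw [h, zpow_natCast] at hwa; exact hwa
      · rw [h, zpow_neg, zpow_natCast, inv_eq_one] at hwa; exact hwa)
    (hX.insert z) (Set.insert_subset ⟨g, hg, hz.symm⟩ hX')
  refine hΦ.single_sub_one_mem_of_linearIndependent hn hi hd hv hvi
    ⟨hg, z, hvX (Set.mem_insert z X), hz.symm⟩ (cubeSpan_mono Φ (layer_mono ?_) d h)
  exact (Subgroup.closure_le _).2 ((Set.subset_insert z X).trans hvX)

/-- Cubes of dimension at least `n + 1` exceed every weight `i ≤ n`, so the descent can be repeated
through all layers without loss of dimension. -/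
theorem IsFiltration.eq_one_of_single_sub_one_mem (hΦ : IsFiltration Φ) (hn : Φ (n + 1) = {1})
    (hI : IsIsolated Φ n) {g : L}
    (hg : MonoidAlgebra.single g (1 : k) - 1 ∈ augPow k L (n + 1)) : g = 1 := by
  have key : ∀ i, i ≤ n → g ∈ Φ (i + 1) ∧
      MonoidAlgebra.single g (1 : k) - 1 ∈ cubeSpan k Φ (Φ (i + 1)) (n + 1) := by
    intro i
    induction i with
    | zero => exact fun _ => ⟨hΦ.mem_one g, augPow_le_cubeSpan hΦ _ hg⟩
    | succ i ih =>
      intro hi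
      obtain ⟨h1, h2⟩ := ih (by omega)
      exact hΦ.single_sub_one_mem_succ hn hI (by omega) hi (by omega) h1 h2
  have := (key n le_rfl).1
  rwa [hn] at this

variable (k) in
/-- In a torsion-free nilpotent loop, only the identity is congruent to `1` modulo a sufficiently
high power of the augmentation ideal. -/
theorem eq_one_of_single_sub_one_mem_augPow (htf : IsTorsionFree L) (hn : gamma L (n + 1) = {1})
    {g : L} (hg : MonoidAlgebra.single g (1 : k) - 1 ∈ augPow k L (n + 1)) : g = 1 := by
  obtain ⟨Φ, hΦ, h1, hI⟩ := exists_isIsolated htf isFiltration_gamma hn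
  exact hΦ.eq_one_of_single_sub_one_mem h1 hI hg

end Layers

/-! ### Invertible elements of the quotient algebra, and injectivity. -/

section InvertibleElements

variable {k L : Type*} [Field k] [AlgebraicLoop L] {m : ℕ}

theorem coe_eq_coe {a b : MonoidAlgebra k L} :
    (a : LoopAlgebraQuotient k L m) = b ↔ a - b ∈ augPow k L m := by
  rw [RingCon.eq, TwoSidedIdeal.rel_iff, mem_idealPow]

theorem sub_smul_mul_mem_augPow (a : MonoidAlgebra k L) {j : ℕ} {x : MonoidAlgebra k L}
    (hx : x ∈ augPow k L j) : a * x - augmentation k L a • x ∈ augPow k L (j + 1) := by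
  have := mul_mem_augPow (sub_augmentation_mem_augPow a) hx
  rwa [sub_mul, smul_mul_assoc, one_mul, add_comm] at this

theorem mul_sub_smul_mem_augPow (a : MonoidAlgebra k L) {j : ℕ} {x : MonoidAlgebra k L}
    (hx : x ∈ augPow k L j) : x * a - augmentation k L a • x ∈ augPow k L (j + 1) := by
  have := mul_mem_augPow hx (sub_augmentation_mem_augPow a)
  rwa [mul_sub, mul_smul_comm, mul_one] at this

/-- A linear operator that is congruent to a nonzero scalar on the augmentation powers induces a
bijection of the quotient. -/
theorem bijective_of_sub_smul_mem (hm : 1 ≤ m) {c : k} (hc : c ≠ 0)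
    {f : MonoidAlgebra k L →ₗ[k] MonoidAlgebra k L}
    (hf : ∀ j, ∀ x ∈ augPow k L j, f x - c • x ∈ augPow k L (j + 1))
    (haug : ∀ x, augmentation k L (f x) = c * augmentation k L x)
    {F : LoopAlgebraQuotient k L m → LoopAlgebraQuotient k L m}
    (hF : ∀ x : MonoidAlgebra k L, F x = (f x : MonoidAlgebra k L)) : Function.Bijective F := by
  constructor
  · intro x y hxy
    obtain ⟨x, rfl⟩ := RingCon.mk'_surjective _ x
    obtain ⟨y, rfl⟩ := RingCon.mk'_surjective _ y
    have h := coe_eq_coe.1 ((hF x).symm.trans (hxy.trans (hF y)))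
    rw [← map_sub] at h
    refine coe_eq_coe.2 ?_
    -- The augmentation gives the case `j = 1`; afterwards `c • (x - y)` agrees with `f (x - y) ∈ Δ
    -- ^ m` up to `Δ ^ (j + 1)`.
    have key : ∀ j, 1 ≤ j → j ≤ m → x - y ∈ augPow k L j := by
      intro j hj
      induction j, hj using Nat.le_induction with
      | base =>
        intro h1
        have h0 := mem_augPow_one.1 (augPow_anti h1 h)
        rw [haug] at h0
        exact mem_augPow_one.2 ((mul_eq_zero.1 h0).resolve_left hc)
      | succ j _ ih =>
        intro hjm
        have h1 := sub_mem (augPow_anti hjm h) (hf j _ (ih (by omega)))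
        rw [sub_sub_cancel] at h1
        exact (Submodule.smul_mem_iff _ hc).1 h1
    exact key m hm le_rfl
  · intro b
    obtain ⟨b, rfl⟩ := RingCon.mk'_surjective _ b
    -- Successive approximation: correcting `x` by `c⁻¹` times the error gains one power of `Δ`.
    have key : ∀ j, 1 ≤ j → ∃ x, f x - b ∈ augPow k L j := by
      intro j hj
      induction j, hj using Nat.le_induction with
      | base =>
        refine ⟨(c⁻¹ * augmentation k L b) • 1, mem_augPow_one.2 ?_⟩
        rw [map_sub, haug, map_smul, augmentation_one, smul_eq_mul, mul_one,
          mul_inv_cancel_left₀ hc, sub_self]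
      | succ j _ ih =>
        obtain ⟨x, hx⟩ := ih
        refine ⟨x - c⁻¹ • (f x - b), ?_⟩
        have := Submodule.smul_mem _ (-c⁻¹) (hf j _ hx)
        convert this using 1
        rw [map_sub, map_smul, smul_sub, smul_smul, neg_mul, inv_mul_cancel₀ hc]
        module
    obtain ⟨x, hx⟩ := key m hm
    exact ⟨x, (hF x).trans (coe_eq_coe.2 hx)⟩

/-- An element of `Δ` cannot divide `1`, because `Δ ^ m ⊆ Δ`. Otherwise both multiplications by `a`
are a nonzero scalar on each `Δ ^ j / Δ ^ (j + 1)`. -/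
theorem isInvertibleElement_coe (hm : 1 ≤ m) {a : MonoidAlgebra k L} :
    IsInvertibleElement (a : LoopAlgebraQuotient k L m) ↔ augmentation k L a ≠ 0 := by
  constructor
  · intro h h0
    obtain ⟨x, hx⟩ := h.1.2 1
    obtain ⟨x, rfl⟩ := RingCon.mk'_surjective _ x
    have h1 := mem_augPow_one.1 (augPow_anti hm (coe_eq_coe (b := 1).1 hx))
    rw [map_sub, map_mul, h0, zero_mul, augmentation_one, zero_sub, neg_eq_zero] at h1
    exact one_ne_zero h1
  · intro h
    exact ⟨bijective_of_sub_smul_mem hm h (f := LinearMap.mulLeft k a)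
        (fun _ _ hx => sub_smul_mul_mem_augPow a hx) (fun x => map_mul _ _ _) (fun _ => rfl),
      bijective_of_sub_smul_mem hm h (f := LinearMap.mulRight k a)
        (fun _ _ hx => mul_sub_smul_mem_augPow a hx)
        (fun x => (map_mul _ _ _).trans (mul_comm _ _)) (fun _ => rfl)⟩

theorem formsLoop_isInvertibleElement (hm : 1 ≤ m) :
    FormsLoop {a : LoopAlgebraQuotient k L m | IsInvertibleElement a} where
  one_mem := (isInvertibleElement_coe hm (a := 1)).2 (by
    rw [augmentation_one]
    exact one_ne_zero)
  mul_mem a ha b hb := by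
    obtain ⟨a, rfl⟩ := RingCon.mk'_surjective _ a
    obtain ⟨b, rfl⟩ := RingCon.mk'_surjective _ b
    refine (isInvertibleElement_coe hm (a := a * b)).2 ?_
    rw [map_mul]
    exact mul_ne_zero ((isInvertibleElement_coe hm).1 ha) ((isInvertibleElement_coe hm).1 hb)
  left_division a ha b hb := by
    obtain ⟨x, hx⟩ := ha.1.2 b
    refine ⟨x, ⟨?_, hx⟩, fun y hy => ha.1.1 (hy.2.trans hx.symm)⟩
    obtain ⟨a, rfl⟩ := RingCon.mk'_surjective _ a
    obtain ⟨x, rfl⟩ := RingCon.mk'_surjective _ x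
    subst hx
    have := (isInvertibleElement_coe hm (a := a * x)).1 hb
    rw [map_mul] at this
    exact (isInvertibleElement_coe hm).2 (right_ne_zero_of_mul this)
  right_division a ha b hb := by
    obtain ⟨x, hx⟩ := ha.2.2 b
    refine ⟨x, ⟨?_, hx⟩, fun y hy => ha.2.1 (hy.2.trans hx.symm)⟩
    obtain ⟨a, rfl⟩ := RingCon.mk'_surjective _ a
    obtain ⟨x, rfl⟩ := RingCon.mk'_surjective _ x
    subst hx
    have := (isInvertibleElement_coe hm (a := x * a)).1 hb
    rw [map_mul] at this
    exact (isInvertibleElement_coe hm).2 (left_ne_zero_of_mul this)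

theorem isInvertibleElement_toLoopAlgebraQuotient (hm : 1 ≤ m) (g : L) :
    IsInvertibleElement (toLoopAlgebraQuotient k L m g) :=
  (isInvertibleElement_coe hm (a := MonoidAlgebra.single g 1)).2 (by
    rw [augmentation_single]
    exact one_ne_zero)

variable (k) in
theorem toLoopAlgebraQuotient_injective [CharZero k] {n : ℕ} (htf : IsTorsionFree L)
    (hn : gamma L (n + 1) = {1}) : Function.Injective (toLoopAlgebraQuotient k L (n + 1)) := by
  intro g h hgh
  have h1 : toLoopAlgebraQuotient k L (n + 1) (ldiv h g) = 1 := by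
    refine (isInvertibleElement_toLoopAlgebraQuotient (Nat.le_add_left 1 n) h).1.1 ?_
    change _ * _ = _ * _
    rw [← map_mul, mul_ldiv, hgh, mul_one]
  have h2 := eq_one_of_single_sub_one_mem_augPow k htf hn
    (coe_eq_coe (a := MonoidAlgebra.single (ldiv h g) 1) (b := 1).1 h1)
  rw [ldiv_eq_iff.1 h2, mul_one]

end InvertibleElements

/-! ### Finite dimension of the quotient algebra. -/

section FiniteDimensional

variable {k L : Type*} [Field k] [AlgebraicLoop L]

variable (k L) in
/-- The homomorphism from the abelianization to `Δ / Δ²` sending the class of `g` to that of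
`g - 1`. -/
noncomputable def abelianizationHom :
    LoopAbelianization L →* Multiplicative (MonoidAlgebra k L ⧸ augPow k L 2) := by
  let θ : L →* Multiplicative (MonoidAlgebra k L ⧸ augPow k L 2) :=
    { toFun := fun g => Multiplicative.ofAdd
        ((augPow k L 2).mkQ (MonoidAlgebra.single g (1 : k) - 1))
      map_one' := by
        rw [← MonoidAlgebra.one_def, sub_self, map_zero]
        rfl
      map_mul' := fun g h => by
        rw [← ofAdd_add, ← map_add]
        refine congrArg Multiplicative.ofAdd ((Submodule.Quotient.eq _).2 ?_)
        have e : MonoidAlgebra.single (g * h) (1 : k) - 1 -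
            (MonoidAlgebra.single g 1 - 1 + (MonoidAlgebra.single h 1 - 1)) =
            (MonoidAlgebra.single g 1 - 1) * (MonoidAlgebra.single h 1 - 1) := by
          rw [sub_mul, mul_sub, MonoidAlgebra.single_mul_single, mul_one, mul_one, one_mul]
          abel
        rw [e]
        refine mul_mem_augPow (p := 1) (q := 1) ?_ ?_ <;>
        exact mem_augPow_one.2 (by
          rw [map_sub, augmentation_single, augmentation_one, sub_self]) }
  have hθ : conGen (AbelianRel (L := L)) ≤ Con.ker θ := Con.conGen_le.2 fun x y h => by
    rw [Con.ker_rel]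
    cases h with
    | comm a b => rw [map_mul, map_mul, mul_comm]
    | assoc a b c => rw [map_mul, map_mul, map_mul, map_mul, mul_assoc]
  exact
    { toFun := Con.lift _ θ hθ
      map_one' := map_one (Con.lift _ θ hθ)
      map_mul' := map_mul (Con.lift _ θ hθ) }

/-- The class of an element in the abelianization. -/
def abelianizationMk (g : L) : LoopAbelianization L := ((conGen (AbelianRel (L := L))).mk' g : _)

/-- A maximal independent family in the abelianization is finite, and a nonzero integer multiple of
each class lies in its span. Modulo `Δ ^ 2` the map `g ↦ g - 1` is additive, and the integer can be
divided out in `k`. -/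
theorem exists_fg_augPow_one_le_sup [CharZero k] (h : AbelianizationHasFiniteRank L) :
    ∃ W : Submodule k (MonoidAlgebra k L), W.FG ∧ augPow k L 1 ≤ W ⊔ augPow k L 2 := by
  let e : L → Additive (LoopAbelianization L) := fun g => Additive.ofMul (abelianizationMk g)
  obtain ⟨s, hs, hmax⟩ := exists_maximal_linearIndepOn ℤ e
  have hfin : s.Finite :=
    Cardinal.lt_aleph0_iff_set_finite.1 (hs.linearIndependent.cardinal_le_rank.trans_lt h)
  let W := Submodule.span k ((fun g : L => MonoidAlgebra.single g (1 : k) - 1) '' s)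
  have key : ∀ g : L, MonoidAlgebra.single g (1 : k) - 1 ∈ W ⊔ augPow k L 2 := by
    intro g
    have mem : ∀ y ∈ Submodule.span ℤ (e '' s), (abelianizationHom k L y.toMul).toAdd ∈
        W.map (augPow k L 2).mkQ := by
      intro y hy
      induction hy using Submodule.span_induction with
      | zero => rw [toMul_zero, map_one, toAdd_one]; exact zero_mem _
      | add x y _ _ hx hy => rw [toMul_add, map_mul, toAdd_mul]; exact add_mem hx hy
      | smul c x _ hx => rw [toMul_zsmul, map_zpow, toAdd_zpow]; exact zsmul_mem hx c
      | mem x hx =>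
        obtain ⟨g, hg, rfl⟩ := hx
        exact Submodule.mem_map_of_mem (Submodule.subset_span ⟨g, hg, rfl⟩)
    obtain ⟨a, ha, hag⟩ : ∃ a : ℤ, a ≠ 0 ∧ a • e g ∈ Submodule.span ℤ (e '' s) := by
      by_cases hg : g ∈ s
      · exact ⟨1, one_ne_zero, by rw [one_smul]; exact Submodule.subset_span ⟨g, hg, rfl⟩⟩
      · exact hmax g hg
    have h1 := mem _ hag
    rw [toMul_zsmul, map_zpow, toAdd_zpow, ← Int.cast_smul_eq_zsmul k,
      Submodule.smul_mem_iff _ (Int.cast_ne_zero.2 ha)] at h1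
    rw [sup_comm, ← Submodule.comap_map_mkQ]
    exact h1
  refine ⟨W, Submodule.fg_span (hfin.image _), fun x hx => ?_⟩
  have h1 := sub_augmentation_mem x
  rw [mem_augPow_one.1 hx, zero_smul, sub_zero] at h1
  refine Submodule.span_le.2 ?_ h1
  rintro _ ⟨g, rfl⟩
  exact key g

theorem IsIdealProduct.one_le {R : Type*} [NonUnitalNonAssocRing R]
    {J : TwoSidedIdeal R} {m : ℕ} {a : R} (h : IsIdealProduct J m a) : 1 ≤ m := by
  induction h with
  | of _ => exact le_rfl
  | mul _ _ ha _ => omega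

/-- Only the outermost product `a * b` matters: both factors lie in `Δ ⊆ W + Δ ^ m`, and replacing
each by its `W`-part costs a term in `Δ ^ (m + 1)`. The condition `2 ≤ m` excludes products of a
single factor. -/
theorem augPow_le_map₂_sup {W : Submodule k (MonoidAlgebra k L)} {m : ℕ} (hm : 2 ≤ m)
    (h : augPow k L 1 ≤ W ⊔ augPow k L m) : augPow k L m ≤
      Submodule.map₂ (LinearMap.mul k (MonoidAlgebra k L)) W W ⊔ augPow k L (m + 1) := by
  refine Submodule.span_le.2 ?_
  rintro _ ⟨m', hm', hx⟩
  rcases hx with ha | @⟨p, q, a, b, ha, hb⟩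
  · omega
  have hp := ha.one_le
  have hq := hb.one_le
  have ha1 : a ∈ augPow k L 1 := augPow_anti hp (Submodule.subset_span ⟨p, le_rfl, ha⟩)
  have hb1 : b ∈ augPow k L 1 := augPow_anti hq (Submodule.subset_span ⟨q, le_rfl, hb⟩)
  obtain ⟨w, hw, r, hr, rfl⟩ := Submodule.mem_sup.1 (h ha1)
  obtain ⟨v, hv, s, hs, rfl⟩ := Submodule.mem_sup.1 (h hb1)
  have hw1 : w ∈ augPow k L 1 := by
    have := sub_mem ha1 (augPow_anti (by omega : 1 ≤ m) hr)
    rwa [add_sub_cancel_right] at this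
  have e : (w + r) * (v + s) = w * v + (r * (v + s) + w * s) := by
    rw [add_mul, mul_add w]
    abel
  rw [e]
  refine add_mem (Submodule.mem_sup_left (Submodule.apply_mem_map₂ (LinearMap.mul k _) hw hv))
    (Submodule.mem_sup_right (add_mem (mul_mem_augPow hr hb1) ?_))
  rw [add_comm m]
  exact mul_mem_augPow hw1 hs

theorem exists_fg_augPow_one_le_sup_augPow {W₀ : Submodule k (MonoidAlgebra k L)} (hW₀ : W₀.FG)
    (h : augPow k L 1 ≤ W₀ ⊔ augPow k L 2) (m : ℕ) :
    ∃ W : Submodule k (MonoidAlgebra k L), W.FG ∧ augPow k L 1 ≤ W ⊔ augPow k L (m + 2) := by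
  induction m with
  | zero => exact ⟨W₀, hW₀, h⟩
  | succ m ih =>
    obtain ⟨W, hW, hWm⟩ := ih
    refine ⟨W ⊔ Submodule.map₂ (LinearMap.mul k (MonoidAlgebra k L)) W W, hW.sup (hW.map₂ _ hW),
      hWm.trans ?_⟩
    rw [sup_assoc]
    exact sup_le_sup_left (augPow_le_map₂_sup (Nat.le_add_left 2 m) hWm) W

theorem finiteDimensional_of_le_sup {m : ℕ} {W : Submodule k (MonoidAlgebra k L)} (hW : W.FG)
    (h : augPow k L 1 ≤ W ⊔ augPow k L m) : FiniteDimensional k (LoopAlgebraQuotient k L m) := by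
  let q : MonoidAlgebra k L →ₗ[k] LoopAlgebraQuotient k L m :=
    { toFun := fun x => x
      map_add' := fun _ _ => rfl
      map_smul' := fun _ _ => rfl }
  refine ⟨?_⟩
  have : (⊤ : Submodule k (LoopAlgebraQuotient k L m)) =
      (Submodule.span k {1} ⊔ W).map q := by
    refine (eq_top_iff.2 fun y _ => ?_).symm
    obtain ⟨y, rfl⟩ := RingCon.mk'_surjective _ y
    obtain ⟨w, hw, r, hr, e⟩ := Submodule.mem_sup.1 (h (sub_augmentation_mem_augPow y))
    refine ⟨augmentation k L y • 1 + w, add_mem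
      (Submodule.mem_sup_left (Submodule.smul_mem _ _ (Submodule.mem_span_singleton_self 1)))
      (Submodule.mem_sup_right hw), coe_eq_coe.2 ?_⟩
    have : augmentation k L y • 1 + w - y = -r := by
      rw [← sub_eq_iff_eq_add.2 e.symm]
      abel
    rw [this]
    exact neg_mem hr
  rw [this]
  exact ((Submodule.fg_span_singleton _).sup hW).map q

theorem finiteDimensional_loopAlgebraQuotient [CharZero k] (h : AbelianizationHasFiniteRank L)
    (m : ℕ) : FiniteDimensional k (LoopAlgebraQuotient k L m) := by
  obtain ⟨W₀, hW₀, h₀⟩ := exists_fg_augPow_one_le_sup (k := k) h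
  obtain ⟨W, hW, hWm⟩ := exists_fg_augPow_one_le_sup_augPow hW₀ h₀ m
  exact finiteDimensional_of_le_sup hW
    (hWm.trans (sup_le_sup_left (augPow_anti (Nat.le_add_right m 2)) W))

end FiniteDimensional

end AlgebraicLoop

theorem mainTheorem5 {k L : Type*} [Field k] [CharZero k] [AlgebraicLoop L] (n : ℕ)
    (htf : AlgebraicLoop.IsTorsionFree L) (hn : AlgebraicLoop.IsNilpotentOfClass L n) :
    Function.Injective (AlgebraicLoop.toLoopAlgebraQuotient k L (n + 1)) ∧
    AlgebraicLoop.FormsLoop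
      {a : AlgebraicLoop.LoopAlgebraQuotient k L (n + 1) | AlgebraicLoop.IsInvertibleElement a} ∧
    (∀ g : L, AlgebraicLoop.IsInvertibleElement
      (AlgebraicLoop.toLoopAlgebraQuotient k L (n + 1) g)) ∧
    (AlgebraicLoop.AbelianizationHasFiniteRank L →
      FiniteDimensional k (AlgebraicLoop.LoopAlgebraQuotient k L (n + 1))) := by
  exact ⟨AlgebraicLoop.toLoopAlgebraQuotient_injective k htf hn.1,
    AlgebraicLoop.formsLoop_isInvertibleElement (Nat.le_add_left 1 n),
    AlgebraicLoop.isInvertibleElement_toLoopAlgebraQuotient (Nat.le_add_left 1 n),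
    fun h => AlgebraicLoop.finiteDimensional_loopAlgebraQuotient h (n + 1)⟩
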